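/- Let $k$ be a commutative unital ring and $G$ a group. Let $B(G,\mathbb{Z})$ be the $\mathbb{Z}G$-module of bounded functions $f\colon G\to\mathbb{Z}$, with $(g\cdot f)(x)=f(g^{-1}x)$, and let $B=B(G,\mathbb{Z})\otimes_{\mathbb{Z}}k$, a $kG$-module. Consider the following classes of $kG$-modules. - $\mathrm{Proj}(kG)$ is the class of projective $kG$-modules. - $\mathrm{Cof}(kG)$ is the class of cofibrant $kG$-modules, i.e. of those $M$ for which $M\otimes_k B$, with the diagonal action $g(x\otimes b)=gx\otimes gb$ of $G$, is a projective $kG$-module. - $\mathrm{GProj}(kG)$ is the class of Gorenstein projective $kG$-modules, i.e. of those modules that are a cokernel of a totally acyclic complex of projective $kG$-modules: an acyclic complex, indexed by $\mathbb{Z}$, of projective $kG$-modules that remains acyclic after applying $\mathrm{Hom}_{kG}(-,P)$ for every projective $kG$-module $P$. - For a class $\mathtt{S}$ of $kG$-modules, $\mathtt{S}^{\perp}$ is the class of those $kG$-modules $N$ such that $\mathrm{Ext}^1_{kG}(M,N)=0$ for all $M\in\mathtt{S}$. Then the following conditions are equivalent: (i) $\mathrm{GProj}(kG)=\mathrm{Cof}(kG)$;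 (ii) $\mathrm{GProj}(kG)\cap\mathrm{Cof}(kG)^{\perp}=\mathrm{Proj}(kG)$; (iii) $\mathrm{GProj}(kG)\cap\mathrm{Cof}(kG)^{\perp}\subseteq\mathrm{Cof}(kG)$; (iv) $\mathrm{GProj}(kG)\cap\mathrm{Cof}(kG)^{\perp}\subseteq\mathrm{GProj}(kG)^{\perp}$. -/

import Mathlib

open CategoryTheory
open scoped TensorProduct

universe u v w

namespace GorensteinCofibrant

noncomputable section

/-! ### Classes of modules over an arbitrary ring -/

section Ring

variable (R : Type u) [Ring R]

/-- The class of projective `R`-modules. -/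
def Proj : ObjectProperty (ModuleCat.{max u w} R) :=
  fun M => Module.Projective R M

variable {R}

/-- The right orthogonal of a class `S` of `R`-modules: the modules `N` with
`Ext¹_R(M, N) = 0` for all `M` in `S`. -/
def rightPerp (S : ObjectProperty (ModuleCat.{max u w} R)) :
    ObjectProperty (ModuleCat.{max u w} R) :=
  fun N => ∀ M : ModuleCat.{max u w} R, S M → Subsingleton (Abelian.Ext M N 1)

/-- A totally acyclic complex of projective modules: an acyclic complex of projective modules,
indexed by `ℤ`, such that for every projective module `P` the complex of abelian groups
`⋯ → Hom(Kⁿ⁺², P) → Hom(Kⁿ⁺¹, P) → Hom(Kⁿ, P) → ⋯` is exact as well. -/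
structure IsTotallyAcyclic (K : CochainComplex (ModuleCat.{max u w} R) ℤ) : Prop where
  projective : ∀ n : ℤ, Proj.{u, w} R (K.X n)
  acyclic : K.Acyclic
  hom_exact : ∀ P : ModuleCat.{max u w} R, Proj.{u, w} R P → ∀ n : ℤ,
    Function.Exact
      (fun f : K.X (n + 2) ⟶ P => K.d (n + 1) (n + 2) ≫ f)
      (fun f : K.X (n + 1) ⟶ P => K.d n (n + 1) ≫ f)

variable (R)

/-- The class of Gorenstein projective `R`-modules: the modules which are (isomorphic to)
a cokernel of a totally acyclic complex of projective modules. -/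
def GProj : ObjectProperty (ModuleCat.{max u w} R) :=
  fun M => ∃ K : CochainComplex (ModuleCat.{max u w} R) ℤ, IsTotallyAcyclic.{u, w} K ∧
    ∃ n : ℤ, Nonempty (M ≅ Limits.cokernel (K.d n (n + 1)))

end Ring

/-! ### Bounded functions and cofibrant modules -/

section GroupAlgebra

variable (k : Type u) (G : Type v) [CommRing k] [Group G]

/-- The group `B(G, ℤ)` of bounded functions from `G` to `ℤ`. -/
def boundedFun : Submodule ℤ (G → ℤ) where
  carrier := {f | ∃ C : ℤ, ∀ x, |f x| ≤ C}
  zero_mem' := ⟨0, fun _ => by simp⟩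
  add_mem' := by
    rintro f f' ⟨C, hC⟩ ⟨C', hC'⟩
    exact ⟨C + C', fun x => (abs_add_le _ _).trans (add_le_add (hC x) (hC' x))⟩
  smul_mem' := by
    rintro a f ⟨C, hC⟩
    refine ⟨|a| * C, fun x => ?_⟩
    simp only [Pi.smul_apply, smul_eq_mul, abs_mul]
    exact mul_le_mul_of_nonneg_left (hC x) (abs_nonneg a)

/-- The action of `G` on `B(G, ℤ)`, given by `(g • f)(x) = f(g⁻¹ x)`. -/
def boundedFunRep : Representation ℤ G (boundedFun G) where
  toFun g :=
    { toFun := fun f => ⟨fun x => f.1 (g⁻¹ * x), by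
        obtain ⟨C, hC⟩ := f.2
        exact ⟨C, fun x => hC _⟩⟩
      map_add' := fun _ _ => rfl
      map_smul' := fun _ _ => rfl }
  map_one' := by
    ext f x
    simp
  map_mul' g h := by
    ext f x
    simp [mul_assoc]

/-- The `kG`-module `B = B(G, k) = k ⊗_ℤ B(G, ℤ)`, as a `k`-linear representation of `G`;
the group acts on the second factor. -/
def boundedRep : Representation k G (k ⊗[ℤ] boundedFun G) where
  toFun g := (boundedFunRep G g).baseChange k
  map_one' := by
    simp only [map_one]
    exact LinearMap.baseChange_id
  map_mul' g h := by
    simp only [map_mul]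
    exact LinearMap.baseChange_comp _ _

/-- The underlying type of the `kG`-module `M ⊗_k B`, with the diagonal action
`g • (x ⊗ b) = g x ⊗ g b` of `G`. -/
abbrev TensorB (M : ModuleCat.{max u v w} (MonoidAlgebra k G)) : Type (max u v w) :=
  ((Representation.ofModule (k := k) (G := G) M).tprod (boundedRep k G)).asModule

/-- The class of cofibrant `kG`-modules: the modules `M` for which the diagonal `kG`-module
`M ⊗_k B` is projective. -/
def Cof : ObjectProperty (ModuleCat.{max u v w} (MonoidAlgebra k G)) :=
  fun M => Module.Projective (MonoidAlgebra k G) (TensorB.{u, v, w} k G M)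

end GroupAlgebra

end

end GorensteinCofibrant

/-! Write 1 for the constant function in B. By Nöbeling's theorem B is free over k, so both - ⊗ B
and Hom_k(B, -) are exact, and they are adjoint.

If M is cofibrant, tensoring k·1 ⊆ B with M embeds M in the projective module M ⊗ B, with cokernel M
⊗ (B/k·1) again cofibrant; kernels of free covers continue this to the left. By adjunction, Ext¹(M,
Hom_k(B, Y)) vanishes for every Y, and a projective P is a summand of Hom_k(B, P), so Ext¹(M, P) =
0. Hence M is Gorenstein projective (`cof_le_gproj`). If moreover M lies in Cof^⊥, the embedding
into M ⊗ B splits and M is projective. Since projectives are both cofibrant and right orthogonal to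
GProj, (i) ⇒ (ii) ⇒ (iii) ⇒ (iv) follows.

For (iv) ⇒ (i), a Gorenstein projective M has a special cofibrant precover 0 → K → C → M → 0 with K
in Cof^⊥ (`exists_cof_precover`). As a kernel of an epimorphism between Gorenstein projectives, K is
Gorenstein projective (`gproj_of_ker`), so (iv) splits the sequence and M is a summand of C.

The precovers exist because Cof^⊥ is detected by a set: closing off under a section of the free
cover of C ⊗ B breaks a cofibrant C into cofibrant pieces with boundedly many generators
(`IsCofRelInjective.extVanish`). The small object argument (`exists_special_preenvelope`) then gives
preenvelopes whose cokernels are left orthogonal to Cof^⊥. Such cokernels are cofibrant, because all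
the modules Hom_k(B, Z) lie in Cof^⊥ (`cof_of_extVanish`). Salce's pushout turns preenvelopes into
precovers. -/

namespace GorensteinCofibrant

/-! ### Vanishing of Ext¹ by extending linear maps -/

section ExtVanish

variable {R : Type*} [Ring R]

/-- The free module on the underlying set of a module. -/
def FreeCover (R M : Type*) [Ring R] : Type _ := M →₀ R

namespace FreeCover

variable {M N : Type*} [AddCommGroup M] [AddCommGroup N] [Module R M] [Module R N]

noncomputable instance : AddCommGroup (FreeCover R M) := inferInstanceAs (AddCommGroup (M →₀ R))

noncomputable instance : Module R (FreeCover R M) := inferInstanceAs (Module R (M →₀ R))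

instance : Module.Free R (FreeCover R M) := inferInstanceAs (Module.Free R (M →₀ R))

variable (R M) in
/-- The canonical projection of the free cover. -/
noncomputable def proj : FreeCover R M →ₗ[R] M := Finsupp.linearCombination R (id : M → M)

lemma proj_surjective : Function.Surjective (proj R M) :=
  fun m => ⟨(Finsupp.single m 1 : M →₀ R), (Finsupp.linearCombination_single R 1 m).trans (one_smul R m)⟩

/-- Functoriality of the free cover. -/
noncomputable def map (f : M →ₗ[R] N) : FreeCover R M →ₗ[R] FreeCover R N :=
  Finsupp.lmapDomain R R f

lemma proj_map (f : M →ₗ[R] N) (x : FreeCover R M) : proj R N (map f x) = f (proj R M x) := by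
  change ((Finsupp.linearCombination R (id : N → N)).comp (Finsupp.lmapDomain R R f)) x =
    (f.comp (Finsupp.linearCombination R (id : M → M))) x
  congr 1; ext; simp

lemma map_map_of_retraction (s : M →ₗ[R] N) (r : N →ₗ[R] M) (h : ∀ x, r (s x) = x)
    (x : FreeCover R M) : map r (map s x) = x := by
  change ((Finsupp.lmapDomain R R r).comp (Finsupp.lmapDomain R R s)) x =
    (LinearMap.id : (M →₀ R) →ₗ[R] _) x
  congr 1; ext; simp [h]

end FreeCover

/-- A linear map factors through a surjective one if it vanishes on its kernel. -/
lemma exists_comp_eq_of_ker_le {X E N : Type*} [AddCommGroup X] [AddCommGroup E] [AddCommGroup N]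
    [Module R X] [Module R E] [Module R N] (φ : X →ₗ[R] E) (hφ : Function.Surjective φ)
    (ψ : X →ₗ[R] N) (h : ∀ x, φ x = 0 → ψ x = 0) : ∃ g : E →ₗ[R] N, ∀ x, g (φ x) = ψ x := by
  refine ⟨((LinearMap.ker φ).liftQ ψ (fun x hx => h x hx)).comp
    (φ.quotKerEquivOfSurjective hφ).symm.toLinearMap, fun x => ?_⟩
  have : (φ.quotKerEquivOfSurjective hφ).symm (φ x) = (LinearMap.ker φ).mkQ x := by
    rw [LinearEquiv.symm_apply_eq]; rfl
  rw [LinearMap.comp_apply, LinearEquiv.coe_coe, this]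
  rfl

/-- Two linear maps with the same source, one being surjective. -/
lemma exists_linearEquiv_of_ker_eq {X E N : Type*} [AddCommGroup X] [AddCommGroup E]
    [AddCommGroup N] [Module R X] [Module R E] [Module R N] (φ : X →ₗ[R] E)
    (hφ : Function.Surjective φ) (ψ : X →ₗ[R] N) (hψ : Function.Surjective ψ)
    (h : ∀ x, φ x = 0 ↔ ψ x = 0) : Nonempty (E ≃ₗ[R] N) :=
  ⟨(φ.quotKerEquivOfSurjective hφ).symm.trans ((Submodule.quotEquivOfEq _ _
    (Submodule.ext h)).trans (ψ.quotKerEquivOfSurjective hψ))⟩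

/-- A short exact sequence of modules. -/
structure IsSES {A E M : Type*} [AddCommGroup A] [AddCommGroup E] [AddCommGroup M]
    [Module R A] [Module R E] [Module R M] (i : A →ₗ[R] E) (p : E →ₗ[R] M) : Prop where
  inj : Function.Injective i
  exact : Function.Exact i p
  surj : Function.Surjective p

section

variable {A E M N : Type*} [AddCommGroup A] [AddCommGroup E] [AddCommGroup M] [AddCommGroup N]
    [Module R A] [Module R E] [Module R M] [Module R N]

lemma IsSES.zero {i : A →ₗ[R] E} {p : E →ₗ[R] M} (h : IsSES i p) (a : A) : p (i a) = 0 :=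
  (h.exact _).2 ⟨a, rfl⟩

lemma isSES_ker {p : E →ₗ[R] M} (hp : Function.Surjective p) :
    IsSES (LinearMap.ker p).subtype p where
  inj := Subtype.val_injective
  exact x := by simp
  surj := hp

lemma isSES_mkQ {i : A →ₗ[R] E} (hi : Function.Injective i) :
    IsSES i (LinearMap.range i).mkQ where
  inj := hi
  exact x := by simp
  surj := Submodule.mkQ_surjective _

/-- A map into the middle of a short exact sequence which dies on the right lifts to the left. -/
lemma IsSES.exists_lift {i : A →ₗ[R] E} {p : E →ₗ[R] M} (h : IsSES i p) (f : N →ₗ[R] E)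
    (hf : ∀ x, p (f x) = 0) : ∃ g : N →ₗ[R] A, ∀ x, i (g x) = f x := by
  refine ⟨(LinearEquiv.ofInjective i h.inj).symm.toLinearMap.comp
    (f.codRestrict (LinearMap.range i) fun x => (h.exact _).1 (hf x)), fun x => ?_⟩
  exact congrArg Subtype.val ((LinearEquiv.ofInjective i h.inj).apply_symm_apply
    (f.codRestrict (LinearMap.range i) (fun x => (h.exact _).1 (hf x)) x))

variable (R M N) in
/-- The vanishing of `Ext¹_R(M, N)`, expressed in terms of the standard free presentation
of `M`. -/
def ExtVanish : Prop :=
  ∀ f : LinearMap.ker (FreeCover.proj R M) →ₗ[R] N,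
    ∃ g : FreeCover R M →ₗ[R] N, ∀ x : LinearMap.ker (FreeCover.proj R M),
      g x = f x

/-- Lift the free cover of M to `σ` with values in E, which sends the relations of M into A. Then E
is a quotient of A ⊕ (free cover), and `f` glues with an extension of its pullback to the relations.
-/
lemma ExtVanish.extend (h : ExtVanish R M N) {i : A →ₗ[R] E} {p : E →ₗ[R] M} (hip : IsSES i p)
    (f : A →ₗ[R] N) : ∃ g : E →ₗ[R] N, ∀ a, g (i a) = f a := by
  obtain ⟨σ, hσ⟩ := Module.projective_lifting_property p
    (FreeCover.proj R M) hip.surj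
  have hσ' : ∀ y, p (σ y) = FreeCover.proj R M y :=
    fun y => LinearMap.congr_fun hσ y
  obtain ⟨σ', h1⟩ := hip.exists_lift
    (σ.comp (LinearMap.ker (FreeCover.proj R M)).subtype)
    (fun x => by simp [hσ'])
  obtain ⟨g0, hg0⟩ := h (f.comp σ')
  obtain ⟨g, hg⟩ := exists_comp_eq_of_ker_le (i.coprod σ) (fun e => by
      obtain ⟨y, hy⟩ := FreeCover.proj_surjective (R := R) (p e)
      obtain ⟨a, ha⟩ := (hip.exact (e - σ y)).1 (by rw [map_sub, hσ', hy, sub_self])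
      exact ⟨(a, y), by simp [ha]⟩) (f.coprod g0) (by
      rintro ⟨a, y⟩ hay
      simp only [LinearMap.coprod_apply] at hay ⊢
      have hy : y ∈ LinearMap.ker (FreeCover.proj R M) := by
        have := congrArg p hay
        rwa [map_add, hip.zero, zero_add, map_zero, hσ'] at this
      have h2 := hg0 ⟨y, hy⟩
      have h3 : σ' ⟨y, hy⟩ = -a := hip.inj (by
        rw [h1]; simpa [eq_neg_iff_add_eq_zero, add_comm] using hay)
      rw [LinearMap.comp_apply, h3, map_neg] at h2
      change g0 y = _ at h2
      rw [h2, add_neg_cancel])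
  exact ⟨g, fun a => by simpa using hg (a, 0)⟩

/-- Any projective presentation computes Ext¹: comparison maps `σ`, `τ` exist both ways, and `ρ`,
the corestriction of `id - τσ` to the relations, corrects for their not being inverse. -/
lemma extVanish_of_presentation [Module.Projective R E] {i : A →ₗ[R] E} {p : E →ₗ[R] M}
    (hip : IsSES i p) (h : ∀ f : A →ₗ[R] N, ∃ g : E →ₗ[R] N, ∀ a, g (i a) = f a) :
    ExtVanish R M N := by
  intro f
  obtain ⟨σ, hσ⟩ := Module.projective_lifting_property p
    (FreeCover.proj R M) hip.surj
  have hσ' : ∀ y, p (σ y) = FreeCover.proj R M y :=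
    fun y => LinearMap.congr_fun hσ y
  obtain ⟨τ, hτ⟩ := Module.projective_lifting_property
    (FreeCover.proj R M) p FreeCover.proj_surjective
  have hτ' : ∀ y, FreeCover.proj R M (τ y) = p y :=
    fun y => LinearMap.congr_fun hτ y
  let K := LinearMap.ker (FreeCover.proj R M)
  let τ' : A →ₗ[R] K := (τ.comp i).codRestrict K (fun a => by
    simp only [K, LinearMap.mem_ker, LinearMap.comp_apply, hτ', hip.zero])
  let ρ : FreeCover R M →ₗ[R] K := (LinearMap.id - τ.comp σ).codRestrict K (fun a => by
    simp [K, LinearMap.mem_ker, hτ', hσ'])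
  obtain ⟨g, hg⟩ := h (f.comp τ')
  refine ⟨g.comp σ + f.comp ρ, fun x => ?_⟩
  obtain ⟨a, ha⟩ := (hip.exact (σ x)).1 ((hσ' _).trans x.2)
  have : ρ x = x - τ' a := Subtype.ext (by simp [ρ, τ', ha])
  simp only [LinearMap.add_apply, LinearMap.comp_apply, this, ← ha, hg, map_sub]
  exact add_sub_cancel _ _

/-- Lifting along a surjection whose kernel is right orthogonal to the source. -/
lemma ExtVanish.lift {p : E →ₗ[R] A} (hp : Function.Surjective p)
    (h : ExtVanish R M (LinearMap.ker p)) (f : M →ₗ[R] A) : ∃ g : M →ₗ[R] E, ∀ x, p (g x) = f x := by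
  let π := FreeCover.proj R M
  obtain ⟨a, ha⟩ := Module.projective_lifting_property p (f.comp π) hp
  have ha' : ∀ y, p (a y) = f (π y) := fun y => LinearMap.congr_fun ha y
  obtain ⟨b, hb⟩ := h ((a.comp (LinearMap.ker π).subtype).codRestrict _ fun x => by
    have := x.2
    rw [LinearMap.mem_ker] at this
    simp [ha', this])
  obtain ⟨g, hg⟩ := exists_comp_eq_of_ker_le π FreeCover.proj_surjective
    (a - (LinearMap.ker p).subtype.comp b) (fun x hx => by
      have := hb ⟨x, hx⟩
      rw [LinearMap.sub_apply, LinearMap.comp_apply, this]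
      exact sub_self _)
  refine ⟨g, fun x => ?_⟩
  obtain ⟨y, rfl⟩ := FreeCover.proj_surjective (R := R) x
  change p (g (π y)) = f (π y)
  have := (b y).2
  rw [LinearMap.mem_ker] at this
  simp [hg, ha', this]

lemma ExtVanish.of_projective [Module.Projective R M] : ExtVanish R M N :=
  extVanish_of_presentation (E := M) (i := (0 : PUnit.{1} →ₗ[R] M)) (p := LinearMap.id)
    ⟨fun _ _ _ => Subsingleton.elim _ _, fun x => by simp [eq_comm], fun x => ⟨x, rfl⟩⟩
    (fun f => ⟨0, fun a => by rw [Subsingleton.elim a 0, map_zero, map_zero, map_zero]⟩)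

lemma ExtVanish.retract_right {N' : Type*} [AddCommGroup N'] [Module R N']
    (h : ExtVanish R M N) (s : N' →ₗ[R] N) (r : N →ₗ[R] N') (hrs : ∀ x, r (s x) = x) :
    ExtVanish R M N' := fun f => by
  obtain ⟨g, hg⟩ := h (s.comp f)
  exact ⟨r.comp g, fun x => by simp [hg, hrs]⟩

lemma ExtVanish.congr_right {N' : Type*} [AddCommGroup N'] [Module R N']
    (h : ExtVanish R M N) (e : N ≃ₗ[R] N') : ExtVanish R M N' :=
  h.retract_right e.symm.toLinearMap e.toLinearMap (by simp)

lemma ExtVanish.retract_left {M' : Type*} [AddCommGroup M'] [Module R M']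
    (h : ExtVanish R M N) (s : M' →ₗ[R] M) (r : M →ₗ[R] M') (hrs : ∀ x, r (s x) = x) :
    ExtVanish R M' N := fun f => by
  let π := FreeCover.proj R M
  let π' := FreeCover.proj R M'
  let S := FreeCover.map s
  let T := FreeCover.map r
  have hT : ∀ x, π' (T x) = r (π x) := FreeCover.proj_map r
  have hS : ∀ x, π (S x) = s (π' x) := FreeCover.proj_map s
  have hTS : ∀ x, T (S x) = x := FreeCover.map_map_of_retraction s r hrs
  obtain ⟨g, hg⟩ := h (f.comp ((T.comp (LinearMap.ker π).subtype).codRestrict _ (fun x => by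
    have := x.2
    rw [LinearMap.mem_ker] at this
    change π' (T x) = 0
    rw [hT, this, map_zero])))
  refine ⟨g.comp S, fun x => ?_⟩
  have hx : S x ∈ LinearMap.ker π := by
    have := x.2
    rw [LinearMap.mem_ker] at this
    rw [LinearMap.mem_ker, hS]
    simp only [π', this, map_zero]
  have := hg ⟨S x, hx⟩
  simp only [LinearMap.comp_apply] at this ⊢
  rw [this]
  congr 1
  exact Subtype.ext (hTS _)

/-- `ExtVanish` is closed under extensions in the first variable. -/
lemma ExtVanish.of_extension {i : A →ₗ[R] E} {p : E →ₗ[R] M} (hip : IsSES i p)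
    (hA : ExtVanish R A N) (hM : ExtVanish R M N) : ExtVanish R E N := by
  intro f
  let π := FreeCover.proj R E
  -- The filtration ker π ⊆ F' ⊆ F has quotients A and M, so `f` extends in two steps.
  let F' := LinearMap.ker (p.comp π)
  have hF : IsSES F'.subtype (p.comp π) :=
    isSES_ker (hip.surj.comp FreeCover.proj_surjective)
  obtain ⟨q, hq⟩ := hip.exists_lift (π.comp F'.subtype) (fun x => x.2)
  have hle : LinearMap.ker π ≤ F' := fun x hx => by
    rw [LinearMap.mem_ker] at hx
    simp [F', hx]
  have hK : IsSES (Submodule.inclusion hle) q :=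
    ⟨Submodule.inclusion_injective hle, fun x => by
      constructor
      · intro hx
        have := hq x
        rw [hx, map_zero] at this
        exact ⟨⟨x, this.symm⟩, rfl⟩
      · rintro ⟨y, rfl⟩
        apply hip.inj
        rw [hq, map_zero]
        exact y.2, fun a => by
      obtain ⟨y, hy⟩ := FreeCover.proj_surjective (R := R) (i a)
      refine ⟨⟨y, ?_⟩, hip.inj ?_⟩
      · simp only [F', LinearMap.mem_ker, LinearMap.comp_apply, π, hy, hip.zero]
      · rw [hq]; exact hy⟩
  obtain ⟨g, hg⟩ := hA.extend hK f
  obtain ⟨g', hg'⟩ := hM.extend hF g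
  exact ⟨g', fun x => by rw [← hg, ← hg']; rfl⟩

/-- If the quotient of a short exact sequence is left orthogonal to the sub, it splits. -/
lemma IsSES.exists_retraction {i : A →ₗ[R] E} {p : E →ₗ[R] M} (hip : IsSES i p)
    (h : ExtVanish R M A) : ∃ r : E →ₗ[R] A, ∀ a, r (i a) = a :=
  h.extend hip LinearMap.id

lemma IsSES.exists_section {i : A →ₗ[R] E} {p : E →ₗ[R] M} (hip : IsSES i p)
    (h : ExtVanish R M A) : ∃ s : M →ₗ[R] E, ∀ a, p (s a) = a :=
  ExtVanish.lift hip.surj (h.congr_right ((LinearEquiv.ofInjective i hip.inj).trans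
    (LinearEquiv.ofEq _ _ (by ext x; exact (hip.exact x).symm)))) LinearMap.id

lemma projective_of_retract [Module.Projective R M] (s : N →ₗ[R] M) (r : M →ₗ[R] N)
    (hrs : ∀ x, r (s x) = x) : Module.Projective R N :=
  Module.Projective.of_split s r (LinearMap.ext hrs)

end

/-- `ExtVanish` agrees with the vanishing of the derived `Ext¹`. -/
lemma subsingleton_ext_iff {R : Type u} [Ring R] (M N : ModuleCat.{max u w} R) :
    Subsingleton (Abelian.Ext M N 1) ↔ ExtVanish R M N := by
  let π := FreeCover.proj R M
  let S : ShortComplex (ModuleCat.{max u w} R) :=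
    ShortComplex.mk (ModuleCat.ofHom (LinearMap.ker π).subtype)
      (ModuleCat.ofHom π) (by ext x; exact x.2)
  have hS : S.ShortExact :=
    { exact := by
        rw [ShortComplex.moduleCat_exact_iff]
        intro x hx
        exact ⟨⟨x, hx⟩, rfl⟩
      mono_f := (ModuleCat.mono_iff_injective _).2 Subtype.val_injective
      epi_g := (ModuleCat.epi_iff_surjective _).2 FreeCover.proj_surjective }
  have : Projective S.X₂ := by
    rw [← IsProjective.iff_projective]
    infer_instance
  constructor
  · intro h f
    obtain ⟨x, hx⟩ := Abelian.Ext.contravariant_sequence_exact₁ hS N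
      (Abelian.Ext.mk₀ (ModuleCat.ofHom f)) rfl (Subsingleton.elim (α := Abelian.Ext M N 1) _ _)
    obtain ⟨g, rfl⟩ := (Abelian.Ext.mk₀_bijective _ _).2 x
    rw [Abelian.Ext.mk₀_comp_mk₀] at hx
    have := (Abelian.Ext.mk₀_bijective _ _).1 hx
    exact ⟨g.hom, fun x => congrArg (fun φ => φ.hom x) this⟩
  · intro h
    refine subsingleton_of_forall_eq 0 fun x => ?_
    obtain ⟨y, hy⟩ := Abelian.Ext.contravariant_sequence_exact₃ hS N x
      (Abelian.Ext.eq_zero_of_projective _) (n₀ := 0) rfl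
    obtain ⟨f, rfl⟩ := (Abelian.Ext.mk₀_bijective _ _).2 y
    obtain ⟨g, hg⟩ := h f.hom
    have : f = S.f ≫ ModuleCat.ofHom g := by
      ext x; exact (hg x).symm
    rw [← hy, this, ← Abelian.Ext.mk₀_comp_mk₀, ← Abelian.Ext.comp_assoc (h₁₂ := rfl) (h₂₃ := rfl) (h := rfl)]
    simp

end ExtVanish

/-! ### Totally acyclic complexes spliced from short exact sequences -/

section GorensteinProjective

variable {R : Type u} [Ring R]

/-- `A` and `M` are the ends of a short exact sequence with projective middle term. -/
def ProjLink (A M : ModuleCat.{max u w} R) : Prop :=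
  ∃ (P : ModuleCat.{max u w} R) (i : A →ₗ[R] P) (p : P →ₗ[R] M),
    Module.Projective R P ∧ IsSES i p

lemma exact_hom_of_acyclic {K : CochainComplex (ModuleCat.{max u w} R) ℤ} (h : K.Acyclic)
    {a b c : ℤ} (hab : a + 1 = b) (hbc : b + 1 = c) :
    Function.Exact (K.d a b).hom (K.d b c).hom := by
  have := h b
  rw [K.exactAt_iff' a b c (by simp [← hab]) (by simp [← hbc]),
    ShortComplex.ShortExact.moduleCat_exact_iff_function_exact] at this
  exact this

/-- Gorenstein projectivity in terms of linear maps. -/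
lemma gproj_iff {M : ModuleCat.{max u w} R} : GProj.{u, w} R M ↔
    ∃ K : CochainComplex (ModuleCat.{max u w} R) ℤ, IsTotallyAcyclic.{u, w} K ∧
      ∃ (n : ℤ) (p : K.X (n + 1) →ₗ[R] M), Function.Exact (K.d n (n + 1)).hom p ∧
        Function.Surjective p := by
  constructor
  · rintro ⟨K, hK, n, ⟨e⟩⟩
    refine ⟨K, hK, n, (Limits.cokernel.π (K.d n (n + 1)) ≫ e.inv).hom, ?_, ?_⟩
    · have := (ShortComplex.ShortExact.moduleCat_exact_iff_function_exact _).1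
        (ShortComplex.exact_cokernel (K.d n (n + 1)))
      intro x
      rw [← this x]
      change e.inv _ = 0 ↔ _
      exact ((injective_iff_map_eq_zero' e.inv.hom).1
        ((ModuleCat.mono_iff_injective e.inv).1 inferInstance)) _
    · exact (ModuleCat.epi_iff_surjective _).1 inferInstance
  · rintro ⟨K, hK, n, p, hp, hs⟩
    have := (ShortComplex.ShortExact.moduleCat_exact_iff_function_exact _).1
        (ShortComplex.exact_cokernel (K.d n (n + 1)))
    obtain ⟨e⟩ := exists_linearEquiv_of_ker_eq p hs (Limits.cokernel.π (K.d n (n + 1))).hom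
      ((ModuleCat.epi_iff_surjective _).1 inferInstance) (fun x => (hp x).trans (this x).symm)
    exact ⟨K, hK, n, ⟨e.toModuleIso⟩⟩

lemma gproj_range {K : CochainComplex (ModuleCat.{max u w} R) ℤ} (hK : IsTotallyAcyclic.{u, w} K)
    (n : ℤ) : GProj.{u, w} R (ModuleCat.of R (LinearMap.range (K.d n (n + 1)).hom)) := by
  obtain ⟨m, rfl⟩ : ∃ m, m + 1 = n := ⟨n - 1, by simp⟩
  refine gproj_iff.2 ⟨K, hK, m, (K.d (m + 1) (m + 1 + 1)).hom.rangeRestrict, ?_,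
    LinearMap.surjective_rangeRestrict _⟩
  intro x
  rw [← exact_hom_of_acyclic hK.acyclic rfl rfl x]
  simp [Subtype.ext_iff]

lemma GProj.exists_next {M : ModuleCat.{max u w} R} (h : GProj.{u, w} R M) :
    ∃ M' : ModuleCat.{max u w} R, GProj.{u, w} R M' ∧ ProjLink.{u, w} M M' := by
  obtain ⟨K, hK, n, p, hp, hs⟩ := gproj_iff.1 h
  refine ⟨_, gproj_range hK (n + 1 + 1), K.X (n + 1 + 1), ?_⟩
  have hd := exact_hom_of_acyclic hK.acyclic (a := n) rfl rfl
  obtain ⟨i, hi⟩ := exists_comp_eq_of_ker_le p hs (K.d (n + 1) (n + 1 + 1)).hom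
    (fun x hx => (hd x).2 ((hp x).1 hx))
  refine ⟨i, (K.d (n + 1 + 1) (n + 1 + 1 + 1)).hom.rangeRestrict, hK.projective _, ?_, ?_,
    LinearMap.surjective_rangeRestrict _⟩
  · rw [injective_iff_map_eq_zero]
    intro x hx
    obtain ⟨y, rfl⟩ := hs x
    rw [hi] at hx
    exact (hp y).2 ((hd y).1 hx)
  · intro x
    rw [Subtype.ext_iff]
    refine (exact_hom_of_acyclic hK.acyclic (a := n + 1) rfl rfl x).trans ?_
    constructor
    · rintro ⟨y, rfl⟩; exact ⟨p y, hi y⟩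
    · rintro ⟨y, rfl⟩
      obtain ⟨z, rfl⟩ := hs y
      exact ⟨z, (hi z).symm⟩

lemma isSES_range_of_exact {A E M : Type*} [AddCommGroup A] [AddCommGroup E] [AddCommGroup M]
    [Module R A] [Module R E] [Module R M] {f : A →ₗ[R] E} {p : E →ₗ[R] M}
    (hp : Function.Exact f p) (hs : Function.Surjective p) :
    IsSES (LinearMap.range f).subtype p :=
  ⟨Subtype.val_injective, fun x => (hp x).trans (by simp), hs⟩

lemma GProj.exists_prev {M : ModuleCat.{max u w} R} (h : GProj.{u, w} R M) :
    ∃ M' : ModuleCat.{max u w} R, GProj.{u, w} R M' ∧ ProjLink.{u, w} M' M := by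
  obtain ⟨K, hK, n, p, hp, hs⟩ := gproj_iff.1 h
  exact ⟨_, gproj_range hK n, K.X (n + 1), _, p, hK.projective _, isSES_range_of_exact hp hs⟩

/-- A map on the image of a differential, precomposed with that differential, is a cocycle of the
Hom complex. Exactness there supplies the extension to the next term. -/
lemma GProj.extVanish {M : ModuleCat.{max u w} R} (h : GProj.{u, w} R M)
    (P : ModuleCat.{max u w} R) (hP : Module.Projective R P) : ExtVanish R M P := by
  obtain ⟨K, hK, n, p, hp, hs⟩ := gproj_iff.1 h
  have := hK.projective (n + 1)
  change Module.Projective R (K.X (n + 1)) at this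
  refine extVanish_of_presentation (isSES_range_of_exact hp hs) fun f => ?_
  obtain ⟨m, rfl⟩ : ∃ m, m + 1 = n := ⟨n - 1, by simp⟩
  have hex := hK.hom_exact P hP m
  rw [show m + 2 = m + 1 + 1 by ring] at hex
  obtain ⟨g, hg⟩ := (hex (ModuleCat.ofHom
    (f.comp (K.d (m + 1) (m + 1 + 1)).hom.rangeRestrict))).1 (by
      ext x
      change f _ = 0
      rw [← map_zero f]
      congr 1
      exact Subtype.ext ((exact_hom_of_acyclic hK.acyclic rfl rfl _).2 ⟨x, rfl⟩))
  refine ⟨g.hom, ?_⟩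
  rintro ⟨_, x, rfl⟩
  exact congrArg (fun φ => φ.hom x) hg

lemma exists_int_sequence {α : Type*} (r : α → α → Prop) (a : α) (hn : ∀ x, ∃ y, r x y)
    (hp : ∀ x, ∃ y, r y x) : ∃ z : ℤ → α, z 0 = a ∧ ∀ n, r (z n) (z (n + 1)) := by
  choose next hnext using hn
  choose prev hprev using hp
  -- The negative constructor of ℤ at `n` stands for -(n+1), hence the n + 1 iterations of `prev`.
  refine ⟨fun n => Int.rec (fun n => next^[n] a) (fun n => prev^[n + 1] a) n, rfl, fun n => ?_⟩
  rcases n with n | n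
  · change r (next^[n] a) (next^[n + 1] a)
    rw [Function.iterate_succ_apply']
    exact hnext _
  · rcases n with - | n
    · exact hprev a
    · change r (prev^[n + 1 + 1] a) (prev^[n + 1] a)
      rw [Function.iterate_succ_apply' prev (n + 1)]
      exact hprev _

/-- A class of modules which is closed under suitable syzygies and cosyzygies and left orthogonal
to the projective modules consists of Gorenstein projective modules. -/
lemma le_gproj (X : ObjectProperty (ModuleCat.{max u w} R))
    (hnext : ∀ M, X M → ∃ M', X M' ∧ ProjLink.{u, w} M M')
    (hprev : ∀ M, X M → ∃ M', X M' ∧ ProjLink.{u, w} M' M)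
    (hext : ∀ M, X M → ∀ P : ModuleCat.{max u w} R, Module.Projective R P → ExtVanish R M P) :
    X ≤ GProj.{u, w} R := by
  intro M hM
  obtain ⟨z, hz0, hz⟩ := exists_int_sequence (α := { M // X M })
    (fun a b => ProjLink.{u, w} a.1 b.1) ⟨M, hM⟩
    (fun x => by obtain ⟨M', h, h'⟩ := hnext x.1 x.2; exact ⟨⟨M', h⟩, h'⟩)
    (fun x => by obtain ⟨M', h, h'⟩ := hprev x.1 x.2; exact ⟨⟨M', h⟩, h'⟩)
  choose P i p hP hip using hz
  let d (n : ℤ) : P n ⟶ P (n + 1) := ModuleCat.ofHom ((i (n + 1)).comp (p n))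
  have hd (n : ℤ) : d n ≫ d (n + 1) = 0 := by
    ext x
    change i (n + 1 + 1) (p (n + 1) (i (n + 1) (p n x))) = 0
    rw [(hip (n + 1)).zero, map_zero]
  let K := CochainComplex.of P d hd
  have hKd (n : ℤ) : K.d n (n + 1) = d n := CochainComplex.of_d _ _ _
  have hexact (n : ℤ) : Function.Exact (i (n + 1) ∘ p n) (i (n + 1 + 1) ∘ p (n + 1)) := by
    intro x
    rw [Function.comp_apply, (injective_iff_map_eq_zero' _).1 (hip (n + 1 + 1)).inj,
      (hip (n + 1)).exact x]
    constructor
    · rintro ⟨y, rfl⟩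
      obtain ⟨t, rfl⟩ := (hip n).surj y
      exact ⟨t, rfl⟩
    · rintro ⟨y, rfl⟩
      exact ⟨_, rfl⟩
  have hK : IsTotallyAcyclic.{u, w} K := by
    refine ⟨hP, fun n => ?_, fun Q hQ n => ?_⟩
    · obtain ⟨m, rfl⟩ : ∃ m, m + 1 = n := ⟨n - 1, by simp⟩
      rw [K.exactAt_iff' m (m + 1) (m + 1 + 1) (by simp) (by simp),
        ShortComplex.ShortExact.moduleCat_exact_iff_function_exact]
      change Function.Exact (K.d m (m + 1)).hom (K.d (m + 1) (m + 1 + 1)).hom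
      rw [hKd, hKd]
      exact hexact m
    · rw [show n + 2 = n + 1 + 1 by ring]
      simp only [hKd]
      intro f
      constructor
      · intro hf
        have hf' : ∀ x, f (i (n + 1) (p n x)) = 0 := fun x => congrArg (fun φ => φ.hom x) hf
        obtain ⟨g, hg⟩ := exists_comp_eq_of_ker_le (p (n + 1)) (hip (n + 1)).surj f.hom
          (fun x hx => by
            obtain ⟨y, rfl⟩ := ((hip (n + 1)).exact x).1 hx
            obtain ⟨t, rfl⟩ := (hip n).surj y
            exact hf' t)
        -- `g` lives on the syzygy `z (n + 2)` inside `P (n + 2)`; the obstruction to extending it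
        -- lies in Ext¹ of the next syzygy.
        obtain ⟨q, hq⟩ := (hext _ (z (n + 1 + 1 + 1)).2 Q hQ).extend (hip (n + 1 + 1)) g
        refine ⟨ModuleCat.ofHom q, ?_⟩
        ext x
        change q (i (n + 1 + 1) (p (n + 1) x)) = f x
        rw [hq, hg]
      · rintro ⟨g, rfl⟩
        change d n ≫ d (n + 1) ≫ g = 0
        rw [← Category.assoc, hd, Limits.zero_comp]
  -- The cokernel of the differential from degree n to n + 1 is `z (n + 2)`, so `M = z 0` occurs at
  -- n = -2.
  refine gproj_iff.2 ⟨K, hK, -1 - 1, ?_⟩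
  have key (n : ℤ) : ∃ q : K.X (n + 1) →ₗ[R] (z (n + 1 + 1)).1,
      Function.Exact (K.d n (n + 1)).hom q ∧ Function.Surjective q := by
    refine ⟨p (n + 1), ?_, (hip (n + 1)).surj⟩
    rw [hKd]
    intro x
    rw [(hip (n + 1)).exact x]
    constructor
    · rintro ⟨y, rfl⟩
      obtain ⟨t, rfl⟩ := (hip n).surj y
      exact ⟨t, rfl⟩
    · rintro ⟨y, rfl⟩
      exact ⟨_, rfl⟩
  have := key (-1 - 1)
  rw [show (-1 - 1 + 1 + 1 : ℤ) = 0 by norm_num, hz0] at this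
  exact this

end GorensteinProjective

/-! ### Extensions and kernels of epimorphisms of Gorenstein projectives -/

section GorensteinClosure

section

variable {R : Type*} [Ring R] {A B C M N : Type*}
  [AddCommGroup A] [AddCommGroup B] [AddCommGroup C] [AddCommGroup M] [AddCommGroup N]
  [Module R A] [Module R B] [Module R C] [Module R M] [Module R N]

/-- The third isomorphism theorem for short exact sequences. -/
lemma IsSES.exists_quotient {i : A →ₗ[R] B} {p : B →ₗ[R] M} {j : B →ₗ[R] C} {q : C →ₗ[R] N}
    (hip : IsSES i p) (hjq : IsSES j q) :
    ∃ (a : M →ₗ[R] C ⧸ LinearMap.range (j.comp i)) (b : (C ⧸ LinearMap.range (j.comp i)) →ₗ[R] N),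
      IsSES a b := by
  let π := (LinearMap.range (j.comp i)).mkQ
  have hπ : ∀ x, π x = 0 ↔ ∃ a, j (i a) = x := fun x => by simp [π]
  obtain ⟨a, ha⟩ := exists_comp_eq_of_ker_le p hip.surj (π.comp j) (fun x hx => by
    obtain ⟨y, rfl⟩ := (hip.exact x).1 hx
    exact (hπ _).2 ⟨y, rfl⟩)
  obtain ⟨b, hb⟩ := exists_comp_eq_of_ker_le π (Submodule.mkQ_surjective _) q (fun x hx => by
    obtain ⟨y, rfl⟩ := (hπ x).1 hx
    exact hjq.zero _)
  refine ⟨a, b, ?_, ?_, ?_⟩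
  · rw [injective_iff_map_eq_zero]
    intro m hm
    obtain ⟨x, rfl⟩ := hip.surj m
    rw [ha] at hm
    obtain ⟨y, hy⟩ := (hπ _).1 hm
    rw [← hjq.inj hy, hip.zero]
  · intro x
    obtain ⟨c, rfl⟩ := Submodule.mkQ_surjective _ x
    rw [hb, hjq.exact c]
    constructor
    · rintro ⟨y, rfl⟩
      exact ⟨p y, ha y⟩
    · rintro ⟨m, hm⟩
      obtain ⟨x, rfl⟩ := hip.surj m
      rw [ha] at hm
      obtain ⟨y, hy⟩ := (hπ (j x - c)).1 (by rw [map_sub]; exact sub_eq_zero.2 hm)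
      exact ⟨x - i y, by rw [map_sub, hy]; abel⟩
  · intro n
    obtain ⟨c, rfl⟩ := hjq.surj n
    exact ⟨π c, hb c⟩

lemma isSES_punit_right : IsSES (LinearMap.id : A →ₗ[R] A) (0 : A →ₗ[R] PUnit.{w + 1}) :=
  ⟨fun _ _ h => h, fun x => by simp, fun x => ⟨0, rfl⟩⟩

lemma isSES_punit_left : IsSES (0 : PUnit.{w + 1} →ₗ[R] A) (LinearMap.id : A →ₗ[R] A) :=
  ⟨fun _ _ _ => rfl, fun x => by simp [eq_comm], fun x => ⟨x, rfl⟩⟩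

end

variable {R : Type u} [Ring R]

lemma proj_le_gproj : Proj.{u, w} R ≤ GProj.{u, w} R := by
  have h0 : Module.Projective R PUnit.{max u w + 1} := inferInstance
  refine le_gproj _ (fun P hP => ⟨ModuleCat.of R PUnit, h0, P, _, _, hP, isSES_punit_right⟩)
    (fun P hP => ⟨ModuleCat.of R PUnit, h0, P, _, _, hP, isSES_punit_left⟩)
    (fun P hP N _ => ?_)
  have : Module.Projective R P := hP
  exact ExtVanish.of_projective

/-- The horseshoe lemma in both directions. To the right, the embedding of A into a projective
extends to E because Ext¹(M, projective) = 0; to the left, the projective cover of M lifts to E as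
usual. -/
lemma gproj_of_extension {A E M : ModuleCat.{max u w} R} {i : A →ₗ[R] E} {p : E →ₗ[R] M}
    (hip : IsSES i p) (hA : GProj.{u, w} R A) (hM : GProj.{u, w} R M) : GProj.{u, w} R E := by
  refine le_gproj (fun E => ∃ (A M : ModuleCat.{max u w} R) (i : A →ₗ[R] E) (p : E →ₗ[R] M),
    IsSES i p ∧ GProj.{u, w} R A ∧ GProj.{u, w} R M) ?_ ?_ ?_ _ ⟨A, M, i, p, hip, hA, hM⟩
  · rintro E ⟨A, M, i, p, hip, hA, hM⟩
    obtain ⟨A', hA', P, j, q, hP, hjq⟩ := hA.exists_next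
    obtain ⟨M', hM', P', j', q', hP', hjq'⟩ := hM.exists_next
    obtain ⟨t, ht⟩ := (hM.extVanish P hP).extend hip j
    let J : E →ₗ[R] P × P' := t.prod (j'.comp p)
    have hJ : Function.Injective J := by
      rw [injective_iff_map_eq_zero]
      intro e he
      obtain ⟨h1, h2⟩ := Prod.ext_iff.1 he
      obtain ⟨a, rfl⟩ := (hip.exact e).1 (hjq'.inj (h2.trans (map_zero j').symm))
      change t (i a) = 0 at h1
      rw [ht] at h1
      rw [hjq.inj (h1.trans (map_zero j).symm), map_zero]
    let π := (LinearMap.range J).mkQ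
    have hπ : ∀ x y, π (x, y) = 0 ↔ ∃ e, t e = x ∧ j' (p e) = y := fun x y => by
      simp [π, J]
    obtain ⟨a, ha⟩ := exists_comp_eq_of_ker_le q hjq.surj (π.comp (LinearMap.inl R P P'))
      (fun x hx => by
        obtain ⟨y, rfl⟩ := (hjq.exact x).1 hx
        exact (hπ _ _).2 ⟨i y, ht y, by rw [hip.zero, map_zero]; rfl⟩)
    obtain ⟨b, hb⟩ := exists_comp_eq_of_ker_le π (Submodule.mkQ_surjective _)
      (q'.comp (LinearMap.snd R P P')) (fun x hx => by
        obtain ⟨e, -, he⟩ := (hπ x.1 x.2).1 hx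
        change q' x.2 = 0
        rw [← he, hjq'.zero])
    refine ⟨ModuleCat.of R ((P × P') ⧸ LinearMap.range J), ⟨A', M', a, b, ⟨?_, ?_, ?_⟩, hA', hM'⟩,
      ModuleCat.of R (P × P'), J, π, inferInstanceAs (Module.Projective R (P × P')),
      isSES_mkQ hJ⟩
    · rw [injective_iff_map_eq_zero]
      intro n hn
      obtain ⟨x, rfl⟩ := hjq.surj n
      rw [ha] at hn
      obtain ⟨e, rfl, he⟩ := (hπ _ _).1 hn
      obtain ⟨y, rfl⟩ := (hip.exact e).1 (hjq'.inj (he.trans (map_zero j').symm))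
      rw [ht, hjq.zero]
    · intro z
      obtain ⟨⟨x, y⟩, rfl⟩ := Submodule.mkQ_surjective _ z
      rw [hb]
      constructor
      · intro hy
        obtain ⟨m, rfl⟩ := (hjq'.exact y).1 hy
        obtain ⟨e, rfl⟩ := hip.surj m
        refine ⟨q (x - t e), ?_⟩
        rw [ha, ← sub_eq_zero]
        change π (x - t e, 0) - π (x, j' (p e)) = 0
        rw [← map_sub]
        exact (hπ _ _).2 ⟨-e, by simp, by simp⟩
      · rintro ⟨n, hn⟩
        obtain ⟨x', rfl⟩ := hjq.surj n
        rw [ha, ← sub_eq_zero] at hn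
        change π (x', 0) - π (x, y) = 0 at hn
        rw [← map_sub] at hn
        obtain ⟨e, -, he⟩ := (hπ (x' - x) (0 - y)).1 hn
        change q' y = 0
        rw [← neg_eq_zero, ← map_neg, ← zero_sub, ← he, hjq'.zero]
    · intro n
      obtain ⟨y, rfl⟩ := hjq'.surj n
      exact ⟨π (0, y), hb _⟩
  · rintro E ⟨A, M, i, p, hip, hA, hM⟩
    obtain ⟨A', hA', P, j, q, hP, hjq⟩ := hA.exists_prev
    obtain ⟨M', hM', P', j', q', hP', hjq'⟩ := hM.exists_prev
    obtain ⟨t, ht⟩ := Module.projective_lifting_property p q' hip.surj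
    replace ht : ∀ y, p (t y) = q' y := fun y => LinearMap.congr_fun ht y
    let T : P × P' →ₗ[R] E := (i.comp q).coprod t
    have hT : ∀ x y, T (x, y) = i (q x) + t y := fun x y => rfl
    have hpT : ∀ x y, p (T (x, y)) = q' y := fun x y => by
      rw [hT, map_add, hip.zero, ht, zero_add]
    have hTs : Function.Surjective T := fun e => by
      obtain ⟨y, hy⟩ := hjq'.surj (p e)
      obtain ⟨a, ha⟩ := (hip.exact (e - t y)).1 (by rw [map_sub, ht, hy, sub_self])
      obtain ⟨x, rfl⟩ := hjq.surj a
      exact ⟨(x, y), by rw [hT, ha]; abel⟩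
    obtain ⟨b, hb⟩ := hjq'.exists_lift ((LinearMap.snd R P P').comp (LinearMap.ker T).subtype)
      (fun x => by
        have h1 := hpT x.1.1 x.1.2
        have h2 : T x.1 = 0 := x.2
        rw [show (x.1.1, x.1.2) = x.1 from rfl, h2, map_zero] at h1
        exact h1.symm)
    let a : A' →ₗ[R] LinearMap.ker T := ((LinearMap.inl R P P').comp j).codRestrict _ (fun x => by
      change T (j x, 0) = 0
      rw [hT, hjq.zero, map_zero, map_zero, add_zero])
    refine ⟨ModuleCat.of R (LinearMap.ker T), ⟨A', M', a, b, ⟨?_, ?_, ?_⟩, hA', hM'⟩,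
      ModuleCat.of R (P × P'), (LinearMap.ker T).subtype, T,
      inferInstanceAs (Module.Projective R (P × P')), isSES_ker hTs⟩
    · intro x y h
      exact hjq.inj (congrArg (fun z => z.1.1) h)
    · rintro ⟨⟨x, y⟩, hxy⟩
      rw [← (injective_iff_map_eq_zero' j').1 hjq'.inj, hb]
      constructor
      · rintro (rfl : y = 0)
        have h : T (x, 0) = 0 := hxy
        rw [hT, map_zero, add_zero] at h
        obtain ⟨z, rfl⟩ := (hjq.exact x).1 (hip.inj (h.trans (map_zero i).symm))
        exact ⟨z, rfl⟩
      · rintro ⟨z, hz⟩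
        exact (congrArg (fun z => z.1.2) hz).symm
    · intro m
      obtain ⟨c, hc⟩ := (hip.exact (t (j' m))).1 (by rw [ht, hjq'.zero])
      obtain ⟨x, rfl⟩ := hjq.surj c
      refine ⟨⟨(-x, j' m), ?_⟩, hjq'.inj (hb _)⟩
      change T (-x, j' m) = 0
      rw [hT, ← hc]; simp
  · rintro E ⟨A, M, i, p, hip, hA, hM⟩ P hP
    exact ExtVanish.of_extension hip (hA.extVanish P hP) (hM.extVanish P hP)

/-- K is a summand of W, but summands are not directly visible in the complexes, so `le_gproj` is
applied to the class of all such kernels. If W embeds in Q with cokernel W', then Q/K is an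
extension of W' by P. If Q maps onto W with kernel W', then ker(Q → P) is projective and maps onto K
with kernel W'. -/
lemma gproj_of_ker_to_projective {K W P : ModuleCat.{max u w} R} {i : K →ₗ[R] W}
    {p : W →ₗ[R] P} (hip : IsSES i p) (hW : GProj.{u, w} R W) (hP : Module.Projective R P) :
    GProj.{u, w} R K := by
  let X : ObjectProperty (ModuleCat.{max u w} R) := fun K => ∃ (W P : ModuleCat.{max u w} R)
    (i : K →ₗ[R] W) (p : W →ₗ[R] P), IsSES i p ∧ GProj.{u, w} R W ∧ Module.Projective R P
  have hX : GProj.{u, w} R ≤ X := fun M hM =>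
    ⟨M, ModuleCat.of R PUnit, LinearMap.id, 0, isSES_punit_right, hM,
      inferInstanceAs (Module.Projective R PUnit.{max u w + 1})⟩
  refine le_gproj X ?_ ?_ ?_ _ ⟨W, P, i, p, hip, hW, hP⟩
  · rintro K ⟨W, P, i, p, hip, hW, hP⟩
    obtain ⟨W', hW', Q, j, q, hQ, hjq⟩ := hW.exists_next
    obtain ⟨a, b, hab⟩ := hip.exists_quotient hjq
    exact ⟨ModuleCat.of R (Q ⧸ LinearMap.range (j.comp i)),
      hX _ (gproj_of_extension (A := P) (M := W') hab (proj_le_gproj _ hP) hW'), Q, j.comp i, _, hQ,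
      isSES_mkQ fun _ _ h => hip.inj (hjq.inj h)⟩
  · rintro K ⟨W, P, i, p, hip, hW, hP⟩
    obtain ⟨W', hW', Q, j, q, hQ, hjq⟩ := hW.exists_prev
    have hs : Function.Surjective (p.comp q) := hip.surj.comp hjq.surj
    obtain ⟨r, hr⟩ := (isSES_ker hs).exists_retraction ExtVanish.of_projective
    obtain ⟨b, hb⟩ := hip.exists_lift (q.comp (LinearMap.ker (p.comp q)).subtype) (fun x => x.2)
    obtain ⟨a, ha⟩ := (isSES_ker hs).exists_lift j (fun x => by
      rw [LinearMap.comp_apply, hjq.zero, map_zero])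
    refine ⟨W', hX _ hW', ModuleCat.of R (LinearMap.ker (p.comp q)), a, b,
      projective_of_retract (M := Q) _ r hr, ?_, ?_, ?_⟩
    · intro x y h
      apply hjq.inj
      rw [← ha, ← ha, h]
    · intro x
      rw [← (injective_iff_map_eq_zero' i).1 hip.inj, hb]
      refine (hjq.exact _).trans ⟨?_, ?_⟩
      · rintro ⟨y, hy⟩
        exact ⟨y, Subtype.ext ((ha y).trans hy)⟩
      · rintro ⟨y, rfl⟩
        exact ⟨y, (ha y).symm⟩
    · intro x
      obtain ⟨y, hy⟩ := hjq.surj (i x)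
      refine ⟨⟨y, ?_⟩, hip.inj ((hb _).trans hy)⟩
      rw [LinearMap.mem_ker, LinearMap.comp_apply, hy, hip.zero]
  · rintro K ⟨W, P, i, p, hip, hW, hP⟩ Q hQ
    obtain ⟨r, hr⟩ := hip.exists_retraction ExtVanish.of_projective
    exact (hW.extVanish Q hQ).retract_left i r hr

/-- Schanuel's argument: the fibre product of two presentations of M is an extension of P by the
Gorenstein projective L, and K is the kernel of its projection onto the projective Q. -/
lemma gproj_of_projLink {K M : ModuleCat.{max u w} R} (h : ProjLink.{u, w} K M)
    (hM : GProj.{u, w} R M) : GProj.{u, w} R K := by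
  obtain ⟨P, i, p, hP, hip⟩ := h
  obtain ⟨L, hL, Q, j, q, hQ, hjq⟩ := hM.exists_prev
  let W := LinearMap.eqLocus (p.comp (LinearMap.fst R P Q)) (q.comp (LinearMap.snd R P Q))
  have h1 : IsSES (((LinearMap.inr R P Q).comp j).codRestrict W (fun x => by simp [W, hjq.zero]))
      ((LinearMap.fst R P Q).comp W.subtype) := by
    refine ⟨fun x y h => hjq.inj (congrArg (fun z => z.1.2) h), ?_, fun x => ?_⟩
    · rintro ⟨⟨x, y⟩, hxy : p x = q y⟩
      constructor
      · rintro (rfl : x = 0)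
        rw [map_zero] at hxy
        obtain ⟨z, rfl⟩ := (hjq.exact y).1 hxy.symm
        exact ⟨z, rfl⟩
      · rintro ⟨z, hz⟩
        exact (congrArg (fun z => z.1.1) hz).symm
    · obtain ⟨y, hy⟩ := hjq.surj (p x)
      exact ⟨⟨(x, y), hy.symm⟩, rfl⟩
  have h2 : IsSES (((LinearMap.inl R P Q).comp i).codRestrict W (fun x => by simp [W, hip.zero]))
      ((LinearMap.snd R P Q).comp W.subtype) := by
    refine ⟨fun x y h => hip.inj (congrArg (fun z => z.1.1) h), ?_, fun y => ?_⟩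
    · rintro ⟨⟨x, y⟩, hxy : p x = q y⟩
      constructor
      · rintro (rfl : y = 0)
        rw [map_zero] at hxy
        obtain ⟨z, rfl⟩ := (hip.exact x).1 hxy
        exact ⟨z, rfl⟩
      · rintro ⟨z, hz⟩
        exact (congrArg (fun z => z.1.2) hz).symm
    · obtain ⟨x, hx⟩ := hip.surj (q y)
      exact ⟨⟨(x, y), hx⟩, rfl⟩
  exact gproj_of_ker_to_projective (W := ModuleCat.of R W) h2
    (gproj_of_extension (E := ModuleCat.of R W) h1 hL (proj_le_gproj _ hP)) hQ

/-- The class of Gorenstein projective modules is closed under kernels of epimorphisms. -/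
lemma gproj_of_ker {K C M : ModuleCat.{max u w} R} {i : K →ₗ[R] C} {p : C →ₗ[R] M}
    (hip : IsSES i p) (hC : GProj.{u, w} R C) (hM : GProj.{u, w} R M) : GProj.{u, w} R K := by
  -- With C embedded in P, the quotient P/K is an extension of C' by M, which makes K a syzygy of a
  -- Gorenstein projective module.
  obtain ⟨C', hC', P, j, q, hP, hjq⟩ := hC.exists_next
  obtain ⟨a, b, hab⟩ := hip.exists_quotient hjq
  exact gproj_of_projLink ⟨P, j.comp i, _, hP, isSES_mkQ fun _ _ h => hip.inj (hjq.inj h)⟩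
    (gproj_of_extension (A := M) (M := C')
      (E := ModuleCat.of R (P ⧸ LinearMap.range (j.comp i))) hab hM hC')

end GorensteinClosure

/-! ### The small object argument and special preenvelopes -/

section SmallObject

/-- Lifting the ring to the universe of the modules reduces to the case of equal universes. -/
lemma isGrothendieckAbelian_moduleCat (R : Type u) [Ring R] :
    IsGrothendieckAbelian.{max u w} (ModuleCat.{max u w} R) :=
  IsGrothendieckAbelian.of_equivalence (C := ModuleCat.{max u w} (ULift.{max u w} R))
    (ModuleCat.restrictScalarsEquivalenceOfRingEquiv
      (ULift.ringEquiv : ULift.{max u w} R ≃+* R).symm)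

-- For κ regular and larger than the number of subobjects of every `A i`, Hom(A i, -) commutes with
-- κ-indexed colimits of monomorphisms. Only these occur, since cell attachments along monomorphisms
-- are monomorphisms.
open MorphismProperty in
lemma hasSmallObjectArgument_ofHoms {C : Type u} [Category.{v} C] [Abelian C]
    [IsGrothendieckAbelian.{w} C] {ι : Type w} {A F : ι → C} (j : ∀ i, A i ⟶ F i)
    [∀ i, Mono (j i)] : HasSmallObjectArgument.{w} (ofHoms j) := by
  obtain ⟨κ, hκ', hκ⟩ := HasCardinalLT.exists_regular_cardinal_forall.{w}
    (fun i => Subobject (A i))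
  have : Fact κ.IsRegular := ⟨hκ'⟩
  have : Nonempty κ.ord.ToType := by simpa using hκ'.ne_zero
  have := WellFoundedLT.toOrderBot κ.ord.ToType
  have hmono : ofHoms j ≤ monomorphisms C := by
    rintro _ _ _ ⟨i⟩
    exact inferInstanceAs (Mono (j i))
  exact ⟨κ, inferInstance, inferInstance,
    { preservesColimit {A B X Y} i hi f hf := by
        let hf' : (monomorphisms C).TransfiniteCompositionOfShape κ.ord.ToType f :=
          { toTransfiniteCompositionOfShape := hf.toTransfiniteCompositionOfShape
            map_mem j hj := by
              have := (hf.attachCells j hj).pushouts_coproducts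
              simp only [ofHoms_homFamily] at this
              refine (?_ : _ ≤ monomorphisms C) _ this
              simp only [pushouts_le_iff, coproducts_le_iff]
              exact hmono }
        have (j j' : κ.ord.ToType) (φ : j ⟶ j') : Mono (hf'.F.map φ) := hf'.mem_map φ
        obtain ⟨S⟩ := hi
        exact IsGrothendieckAbelian.preservesColimit_coyoneda_obj_of_mono
          (Y := hf'.F) (κ := κ) (hκ S) }⟩

open Limits ZeroObject in
/-- Special preenvelopes with respect to a set of monomorphisms into projective modules. -/
lemma exists_special_preenvelope {R : Type u} [Ring R] {ι : Type (max u w)}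
    {A F : ι → ModuleCat.{max u w} R} (j : ∀ i, A i →ₗ[R] F i)
    (hj : ∀ i, Function.Injective (j i)) (hF : ∀ i, Module.Projective R (F i))
    (N : ModuleCat.{max u w} R) :
    ∃ (E : ModuleCat.{max u w} R) (e : N →ₗ[R] E), Function.Injective e ∧
      (∀ i (f : A i →ₗ[R] E), ∃ g : F i →ₗ[R] E, ∀ x, g (j i x) = f x) ∧
      ∀ Y : ModuleCat.{max u w} R,
        (∀ i (f : A i →ₗ[R] Y), ∃ g : F i →ₗ[R] Y, ∀ x, g (j i x) = f x) →
        ExtVanish R (E ⧸ LinearMap.range e) Y := by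
  have : IsGrothendieckAbelian.{max u w} (ModuleCat.{max u w} R) :=
    isGrothendieckAbelian_moduleCat.{u, w} R
  let J : ∀ i, A i ⟶ F i := fun i => ModuleCat.ofHom (j i)
  have (i : ι) : Mono (J i) := (ModuleCat.mono_iff_injective _).2 (hj i)
  have := hasSmallObjectArgument_ofHoms J
  let I := MorphismProperty.ofHoms J
  let fac := MorphismProperty.factorizationData I.rlp.llp I.rlp (0 : N ⟶ 0)
  refine ⟨fac.Z, fac.i.hom, ?_, ?_, ?_⟩
  · have h0 : I.rlp (0 : Injective.under N ⟶ 0) := by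
      rintro _ _ _ ⟨i⟩
      exact ⟨fun {f _} sq => ⟨⟨⟨Injective.factorThru f (J i), Injective.comp_factorThru _ _,
        (Limits.isZero_zero _).eq_of_tgt _ _⟩⟩⟩⟩
    have hl := fac.hi _ h0
    have sq : CommSq (Injective.ι N) fac.i (0 : Injective.under N ⟶ 0) 0 :=
      ⟨(Limits.isZero_zero _).eq_of_tgt _ _⟩
    have := sq.fac_left
    have hm : Mono (fac.i ≫ sq.lift) := by rw [this]; infer_instance
    exact (ModuleCat.mono_iff_injective _).1 (mono_of_mono fac.i sq.lift)
  · intro i f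
    have hr := fac.hp _ (MorphismProperty.ofHoms.mk i : I (J i))
    have sq : CommSq (ModuleCat.ofHom f) (J i) fac.p 0 :=
      ⟨(Limits.isZero_zero _).eq_of_tgt _ _⟩
    exact ⟨sq.lift.hom, fun x => congrArg (fun φ => φ.hom x) sq.fac_left⟩
  · intro Y hY
    let Q := fac.Z ⧸ LinearMap.range fac.i.hom
    let π : fac.Z →ₗ[R] Q := (LinearMap.range fac.i.hom).mkQ
    let P := FreeCover R Q
    let K := LinearMap.ker (FreeCover.proj R Q)
    intro f
    -- the pushout of the free presentation along `f`
    let Δ : K →ₗ[R] Y × P := f.prod (-K.subtype)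
    let Z := (Y × P) ⧸ LinearMap.range Δ
    let α : Y × P →ₗ[R] Z := (LinearMap.range Δ).mkQ
    have hα : ∀ y x, α (y, x) = 0 ↔ ∃ k : K, f k = y ∧ -(k : P) = x := fun y x =>
      (Submodule.Quotient.mk_eq_zero _).trans (exists_congr fun k => Prod.ext_iff)
    let β : Y →ₗ[R] Z := α.comp (LinearMap.inl R Y P)
    obtain ⟨q, hq⟩ := exists_comp_eq_of_ker_le α (Submodule.mkQ_surjective _)
      ((FreeCover.proj R Q).comp (LinearMap.snd R Y P)) (by
        rintro ⟨y, x⟩ h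
        obtain ⟨k, -, rfl⟩ := (hα y x).1 h
        have := k.2
        change FreeCover.proj R Q (-k) = 0
        rw [map_neg, neg_eq_zero]
        exact this)
    have hYq : IsSES β q := by
      refine ⟨?_, ?_, ?_⟩
      · rw [injective_iff_map_eq_zero]
        intro y hy
        obtain ⟨k, rfl, hk⟩ := (hα y 0).1 hy
        rw [show k = 0 from Subtype.ext (neg_eq_zero.1 hk), map_zero]
      · intro z
        obtain ⟨⟨y, x⟩, rfl⟩ := Submodule.mkQ_surjective _ z
        rw [hq]
        constructor
        · intro hx
          refine ⟨y + f ⟨x, hx⟩, ?_⟩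
          rw [← sub_eq_zero]
          change α (y + f ⟨x, hx⟩, 0) - α (y, x) = 0
          rw [← map_sub]
          exact (hα _ _).2 ⟨⟨x, hx⟩, by simp, by simp⟩
        · rintro ⟨y', hy'⟩
          rw [← hq]
          change q (α (y, x)) = 0
          change α (y', 0) = α (y, x) at hy'
          rw [← hy', hq]
          exact map_zero (FreeCover.proj R Q)
      · intro x
        obtain ⟨y, rfl⟩ := FreeCover.proj_surjective (R := R) x
        exact ⟨α (0, y), hq _⟩
    -- Lift the bottom map by projectivity of `F i`; the error on `A i` takes values in Y and
    -- extends to `F i` by hypothesis on Y.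
    have hr : I.rlp (ModuleCat.ofHom q : ModuleCat.of R Z ⟶ ModuleCat.of R Q) := by
      rintro _ _ _ ⟨i⟩
      refine ⟨fun {f g} sq => ?_⟩
      have hsq : ∀ x, q (f.hom x) = g.hom (j i x) := fun x => congrArg (fun φ => φ.hom x) sq.w
      have := hF i
      obtain ⟨t, ht⟩ := Module.projective_lifting_property q g.hom hYq.surj
      replace ht : ∀ y, q (t y) = g.hom y := fun y => LinearMap.congr_fun ht y
      obtain ⟨c, hc⟩ := hYq.exists_lift (f.hom - t.comp (j i)) (fun x => by
        rw [LinearMap.sub_apply, map_sub, hsq]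
        simp [ht])
      obtain ⟨d, hd⟩ := hY i c
      refine ⟨⟨⟨ModuleCat.ofHom (t + β.comp d), ?_, ?_⟩⟩⟩
      · ext x
        change t (j i x) + β (d (j i x)) = f.hom x
        rw [hd, hc]
        exact add_sub_cancel _ _
      · ext x
        change q (t x + β (d x)) = g.hom x
        rw [map_add, hYq.zero, add_zero, ht]
    have hl := fac.hi _ hr
    -- A diagonal of this square kills N, hence descends to a section of the extension of E/N by Y.
    have sq : CommSq (0 : N ⟶ ModuleCat.of R Z) fac.i (ModuleCat.ofHom q)
        (ModuleCat.ofHom π : fac.Z ⟶ ModuleCat.of R Q) := ⟨by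
      ext x
      change q 0 = π (fac.i.hom x)
      rw [map_zero]
      exact ((Submodule.Quotient.mk_eq_zero (LinearMap.range fac.i.hom)).2 ⟨x, rfl⟩).symm⟩
    obtain ⟨s, hs⟩ := exists_comp_eq_of_ker_le π (Submodule.mkQ_surjective _) sq.lift.hom
      (fun x hx => by
        obtain ⟨y, rfl⟩ := (Submodule.Quotient.mk_eq_zero _).1 hx
        exact congrArg (fun φ => φ.hom y) sq.fac_left)
    have hqs : ∀ x, q (s x) = x := fun x => by
      obtain ⟨y, rfl⟩ := Submodule.mkQ_surjective _ x
      change q (s (π y)) = π y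
      rw [hs]
      exact congrArg (fun φ => φ.hom y) sq.fac_right
    obtain ⟨g, hg⟩ := hYq.exists_lift
      (α.comp (LinearMap.inr R Y P) - s.comp (FreeCover.proj R Q)) (fun x => by
        rw [LinearMap.sub_apply, map_sub, LinearMap.comp_apply, hq]
        exact sub_eq_zero.2 (hqs _).symm)
    refine ⟨g, fun k => hYq.inj ?_⟩
    rw [hg, LinearMap.sub_apply, LinearMap.comp_apply s, show FreeCover.proj R Q k = 0 from k.2,
      map_zero, sub_zero, ← sub_eq_zero]
    change α (0, k) - α (f k, 0) = 0
    rw [← map_sub]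
    exact (hα (0 - f k) (k - 0)).2 ⟨-k, by rw [map_neg, zero_sub], by
      rw [sub_zero]; exact neg_neg (k : P)⟩

end SmallObject

/-! ### The adjunction between diagonal tensor products and Hom over k -/

section DiagonalTensor

variable {k G : Type*} [CommRing k] [Group G]

/-- An additive map is linear over the group algebra if it commutes with scalars and with the
group. -/
noncomputable def groupAlgebraLinearMap {A Y : Type*} [AddCommGroup A] [AddCommGroup Y]
    [Module (MonoidAlgebra k G) A] [Module (MonoidAlgebra k G) Y] (f : A →+ Y)
    (hk : ∀ (c : k) a, f (algebraMap k (MonoidAlgebra k G) c • a) =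
      algebraMap k (MonoidAlgebra k G) c • f a)
    (hg : ∀ (g : G) a, f (MonoidAlgebra.of k G g • a) = MonoidAlgebra.of k G g • f a) :
    A →ₗ[MonoidAlgebra k G] Y where
  toFun := f
  map_add' := f.map_add
  map_smul' r a := by
    induction r using MonoidAlgebra.induction_on with
    | of g => exact hg g a
    | add x y hx hy => simp only [add_smul, map_add, hx, hy]
    | smul c x hx =>
      rw [Algebra.smul_def, RingHom.id_apply, mul_smul, mul_smul, hk, hx, RingHom.id_apply]

lemma asModule_of_smul {V : Type*} [AddCommMonoid V] [Module k V] (ρ : Representation k G V)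
    (g : G) (x : ρ.asModule) :
    MonoidAlgebra.of k G g • x = ρ.asModuleEquiv.symm (ρ g (ρ.asModuleEquiv x)) := by
  rw [ρ.asModuleEquiv_symm_map_rho, LinearEquiv.symm_apply_apply]

lemma asModule_algebraMap_smul {V : Type*} [AddCommMonoid V] [Module k V]
    (ρ : Representation k G V) (c : k) (x : ρ.asModule) :
    algebraMap k (MonoidAlgebra k G) c • x = ρ.asModuleEquiv.symm (c • ρ.asModuleEquiv x) := by
  rw [ρ.asModuleEquiv_symm_map_smul, LinearEquiv.symm_apply_apply]

variable {V W : Type*} [AddCommGroup V] [Module k V] [AddCommGroup W] [Module k W]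
  (ρ : Representation k G V) (σ : Representation k G W)

/-- The diagonal tensor product of a module over the group algebra and a representation. -/
noncomputable def Tens (A : Type*) [AddCommGroup A] [Module (MonoidAlgebra k G) A] : Type _ :=
  ((Representation.ofModule (k := k) (G := G) A).tprod ρ).asModule

/-- The module of `k`-linear maps from a representation to a module over the group algebra, with
the conjugation action. -/
noncomputable def LinHom (Y : Type*) [AddCommGroup Y] [Module (MonoidAlgebra k G) Y] : Type _ :=
  (Representation.linHom ρ (Representation.ofModule (k := k) (G := G) Y)).asModule

variable {A A' A'' Y Y' : Type*} [AddCommGroup A] [AddCommGroup A'] [AddCommGroup A'']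
  [AddCommGroup Y] [AddCommGroup Y'] [Module (MonoidAlgebra k G) A] [Module (MonoidAlgebra k G) A']
  [Module (MonoidAlgebra k G) A''] [Module (MonoidAlgebra k G) Y] [Module (MonoidAlgebra k G) Y']

noncomputable instance : AddCommGroup (Tens ρ A) :=
  Module.addCommMonoidToAddCommGroup (MonoidAlgebra k G)
    (M := ((Representation.ofModule (k := k) (G := G) A).tprod ρ).asModule)

noncomputable instance : Module (MonoidAlgebra k G) (Tens ρ A) :=
  inferInstanceAs (Module (MonoidAlgebra k G)
    ((Representation.ofModule (k := k) (G := G) A).tprod ρ).asModule)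

noncomputable instance : AddCommGroup (LinHom ρ Y) :=
  Module.addCommMonoidToAddCommGroup (MonoidAlgebra k G)
    (M := (Representation.linHom ρ (Representation.ofModule (k := k) (G := G) Y)).asModule)

noncomputable instance : Module (MonoidAlgebra k G) (LinHom ρ Y) :=
  inferInstanceAs (Module (MonoidAlgebra k G)
    (Representation.linHom ρ (Representation.ofModule (k := k) (G := G) Y)).asModule)

/-- The `k`-linear map underlying a linear map over the group algebra. -/
noncomputable def scalarMap (f : A →ₗ[MonoidAlgebra k G] A') :
    RestrictScalars k (MonoidAlgebra k G) A →ₗ[k] RestrictScalars k (MonoidAlgebra k G) A' where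
  toFun := f
  map_add' := f.map_add
  map_smul' c := f.map_smul (algebraMap k (MonoidAlgebra k G) c)

namespace LinHom

variable {ρ}

/-- The `k`-linear map underlying an element of `LinHom`. -/
noncomputable def toLin (φ : LinHom ρ Y) : V →ₗ[k] RestrictScalars k (MonoidAlgebra k G) Y := φ

/-- Evaluation of elements of `LinHom`. -/
noncomputable def app (φ : LinHom ρ Y) (v : V) : Y := toLin φ v

variable (ρ) in
/-- Construct an element of `LinHom`. -/
noncomputable def mk (f : V →+ Y) (h : ∀ (c : k) v, f (c • v) = algebraMap k (MonoidAlgebra k G) c • f v) :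
    LinHom ρ Y :=
  show V →ₗ[k] RestrictScalars k (MonoidAlgebra k G) Y from
    { toFun := f, map_add' := f.map_add, map_smul' := h }

lemma ext {φ ψ : LinHom ρ Y} (h : ∀ v, φ.app v = ψ.app v) : φ = ψ :=
  LinearMap.ext (f := toLin φ) (g := toLin ψ) h

@[simp] lemma add_app (φ ψ : LinHom ρ Y) (v : V) : (φ + ψ).app v = φ.app v + ψ.app v := rfl

@[simp] lemma zero_app (v : V) : (0 : LinHom ρ Y).app v = 0 := rfl

@[simp] lemma app_add (φ : LinHom ρ Y) (v w : V) : φ.app (v + w) = φ.app v + φ.app w :=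
  (toLin φ).map_add v w

lemma app_smul (φ : LinHom ρ Y) (c : k) (v : V) :
    φ.app (c • v) = algebraMap k (MonoidAlgebra k G) c • φ.app v :=
  (toLin φ).map_smul c v

lemma of_smul_app (φ : LinHom ρ Y) (g : G) (v : V) :
    (MonoidAlgebra.of k G g • φ).app v = MonoidAlgebra.of k G g • φ.app (ρ g⁻¹ v) := by
  have := asModule_of_smul (Representation.linHom ρ (Representation.ofModule (k := k) (G := G) Y))
    g φ
  refine (congrArg (fun ψ : LinHom ρ Y => ψ.app v) this).trans ?_
  change (MonoidAlgebra.lift k _ G).symm (RestrictScalars.lsmul k (MonoidAlgebra k G) Y) g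
    (toLin φ (ρ g⁻¹ v)) = _
  rfl

lemma algebraMap_smul_app (φ : LinHom ρ Y) (c : k) (v : V) :
    (algebraMap k (MonoidAlgebra k G) c • φ).app v =
      algebraMap k (MonoidAlgebra k G) c • φ.app v := by
  have := asModule_algebraMap_smul
    (Representation.linHom ρ (Representation.ofModule (k := k) (G := G) Y)) c φ
  exact congrArg (fun ψ : LinHom ρ Y => ψ.app v) this

variable (ρ) in
/-- Functoriality of `LinHom`. -/
noncomputable def map (f : Y →ₗ[MonoidAlgebra k G] Y') : LinHom ρ Y →ₗ[MonoidAlgebra k G] LinHom ρ Y' :=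
  groupAlgebraLinearMap
    { toFun := fun φ => (scalarMap f).comp (toLin φ)
      map_zero' := LinHom.ext fun v => f.map_zero
      map_add' := fun φ ψ => LinHom.ext fun v => f.map_add _ _ }
    (fun c φ => LinHom.ext fun v => by
      refine (congrArg f (algebraMap_smul_app φ c v)).trans ?_
      rw [map_smul, algebraMap_smul_app]; rfl)
    (fun g φ => LinHom.ext fun v => by
      refine (congrArg f (of_smul_app φ g v)).trans ?_
      rw [map_smul, of_smul_app]; rfl)

lemma map_surjective [Module.Projective k V] {f : Y →ₗ[MonoidAlgebra k G] Y'}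
    (hf : Function.Surjective f) : Function.Surjective (map ρ f) := fun φ => by
  obtain ⟨ψ, hψ⟩ := Module.projective_lifting_property (scalarMap f) (toLin φ) hf
  exact ⟨ψ, hψ⟩

/-- Evaluation at an invariant vector. -/
noncomputable def evalInvariant {e : V} (he : ∀ g, ρ g e = e) : LinHom ρ Y →ₗ[MonoidAlgebra k G] Y :=
  groupAlgebraLinearMap
    { toFun := fun φ => φ.app e
      map_zero' := rfl
      map_add' := fun _ _ => rfl }
    (fun c φ => algebraMap_smul_app φ c e)
    (fun g φ => (of_smul_app φ g e).trans (by rw [he]; rfl))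

end LinHom

namespace Tens

variable {ρ}

variable (ρ) in
/-- Pure tensors. -/
noncomputable def tmul (a : A) (v : V) : Tens ρ A :=
  (show RestrictScalars k (MonoidAlgebra k G) A from a) ⊗ₜ[k] v

lemma add_tmul (a b : A) (v : V) : tmul ρ (a + b) v = tmul ρ a v + tmul ρ b v :=
  TensorProduct.add_tmul _ _ _

lemma tmul_add (a : A) (v w : V) : tmul ρ a (v + w) = tmul ρ a v + tmul ρ a w :=
  TensorProduct.tmul_add _ _ _

lemma zero_tmul (v : V) : tmul ρ (0 : A) v = 0 := TensorProduct.zero_tmul _ _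

lemma tmul_zero (a : A) : tmul ρ a 0 = 0 := TensorProduct.tmul_zero _ _

lemma of_smul_tmul (g : G) (a : A) (v : V) : MonoidAlgebra.of k G g • tmul ρ a v =
    tmul ρ (MonoidAlgebra.of k G g • a) (ρ g v) :=
  asModule_of_smul ((Representation.ofModule (k := k) (G := G) A).tprod ρ) g (tmul ρ a v)

lemma algebraMap_smul_tmul (c : k) (a : A) (v : V) :
    algebraMap k (MonoidAlgebra k G) c • tmul ρ a v =
      tmul ρ (algebraMap k (MonoidAlgebra k G) c • a) v :=
  asModule_algebraMap_smul ((Representation.ofModule (k := k) (G := G) A).tprod ρ) c (tmul ρ a v)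

lemma tmul_smul (c : k) (a : A) (v : V) :
    tmul ρ a (c • v) = algebraMap k (MonoidAlgebra k G) c • tmul ρ a v :=
  (TensorProduct.tmul_smul c (show RestrictScalars k (MonoidAlgebra k G) A from a) v).trans
    (asModule_algebraMap_smul ((Representation.ofModule (k := k) (G := G) A).tprod ρ) c
      (tmul ρ a v)).symm

@[elab_as_elim]
lemma induction_on {p : Tens ρ A → Prop} (x : Tens ρ A) (h0 : p 0) (h1 : ∀ a v, p (tmul ρ a v))
    (h2 : ∀ x y, p x → p y → p (x + y)) : p x :=
  TensorProduct.induction_on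
    (motive := fun x : RestrictScalars k (MonoidAlgebra k G) A ⊗[k] V => p x) x h0 h1 h2

lemma hom_ext {f f' : Tens ρ A →ₗ[MonoidAlgebra k G] Y}
    (h : ∀ a v, f (tmul ρ a v) = f' (tmul ρ a v)) (x : Tens ρ A) : f x = f' x := by
  induction x using induction_on with
  | h0 => simp
  | h1 a v => exact h a v
  | h2 x y hx hy => rw [map_add, map_add, hx, hy]

/-- Half of the adjunction between `Tens` and `LinHom`. -/
noncomputable def curry (f : Tens ρ A →ₗ[MonoidAlgebra k G] Y) : A →ₗ[MonoidAlgebra k G] LinHom ρ Y :=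
  groupAlgebraLinearMap
    { toFun := fun a => LinHom.mk ρ
        { toFun := fun v => f (tmul ρ a v)
          map_zero' := by rw [tmul_zero, map_zero]
          map_add' := fun v w => by rw [tmul_add, map_add] }
        (fun c v => by
          change f (tmul ρ a (c • v)) = algebraMap k (MonoidAlgebra k G) c • f (tmul ρ a v)
          rw [tmul_smul, map_smul])
      map_zero' := LinHom.ext fun v => by
        change f (tmul ρ 0 v) = 0
        rw [zero_tmul, map_zero]
      map_add' := fun a b => LinHom.ext fun v => by
        change f (tmul ρ (a + b) v) = f (tmul ρ a v) + f (tmul ρ b v)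
        rw [add_tmul, map_add] }
    (fun c a => LinHom.ext fun v => by
      rw [LinHom.algebraMap_smul_app]
      change f (tmul ρ _ v) = _ • f (tmul ρ a v)
      rw [← algebraMap_smul_tmul, map_smul])
    (fun g a => LinHom.ext fun v => by
      rw [LinHom.of_smul_app]
      change f (tmul ρ _ v) = _ • f (tmul ρ a _)
      rw [← map_smul, of_smul_tmul]
      simp)

@[simp] lemma curry_app (f : Tens ρ A →ₗ[MonoidAlgebra k G] Y) (a : A) (v : V) :
    (curry f a).app v = f (tmul ρ a v) := rfl

/-- The `k`-linear map underlying `uncurry`. -/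
noncomputable def uncurryAux (f : A →ₗ[MonoidAlgebra k G] LinHom ρ Y) :
    RestrictScalars k (MonoidAlgebra k G) A ⊗[k] V →ₗ[k]
      RestrictScalars k (MonoidAlgebra k G) Y :=
  TensorProduct.lift
    { toFun := fun a => LinHom.toLin (f a)
      map_add' := fun a b => f.map_add a b
      map_smul' := fun c a => LinHom.ext fun v => by
        refine (congrArg (fun φ => LinHom.app φ v)
          (f.map_smul (algebraMap k (MonoidAlgebra k G) c) a)).trans ?_
        exact LinHom.algebraMap_smul_app _ _ _ }

/-- Half of the adjunction between `Tens` and `LinHom`. -/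
noncomputable def uncurry (f : A →ₗ[MonoidAlgebra k G] LinHom ρ Y) :
    Tens ρ A →ₗ[MonoidAlgebra k G] Y :=
  let F : Tens ρ A →+ Y := (uncurryAux f).toAddMonoidHom
  have hF : ∀ a v, F (tmul ρ a v) = (f a).app v := fun a v => rfl
  groupAlgebraLinearMap F
    (fun c x => by
      induction x using induction_on with
      | h0 => simp
      | h1 a v => rw [algebraMap_smul_tmul, hF, hF, map_smul, LinHom.algebraMap_smul_app]
      | h2 x y hx hy => rw [smul_add, map_add, map_add, hx, hy, smul_add])
    (fun g x => by
      induction x using induction_on with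
      | h0 => simp
      | h1 a v =>
        rw [of_smul_tmul, hF, hF, map_smul, LinHom.of_smul_app]
        simp
      | h2 x y hx hy => rw [smul_add, map_add, map_add, hx, hy, smul_add])

variable (ρ) in
/-- Functoriality of `Tens` in the module. -/
noncomputable def map (f : A →ₗ[MonoidAlgebra k G] A') :
    Tens ρ A →ₗ[MonoidAlgebra k G] Tens ρ A' :=
  let F : Tens ρ A →+ Tens ρ A' := (LinearMap.rTensor V (scalarMap f)).toAddMonoidHom
  have hF : ∀ a v, F (tmul ρ a v) = tmul ρ (f a) v := fun a v => rfl
  groupAlgebraLinearMap F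
    (fun c x => by
      induction x using induction_on with
      | h0 => simp
      | h1 a v => rw [algebraMap_smul_tmul, hF, hF, map_smul, algebraMap_smul_tmul]
      | h2 x y hx hy => rw [smul_add, map_add, map_add, hx, hy, smul_add])
    (fun g x => by
      induction x using induction_on with
      | h0 => simp
      | h1 a v => rw [of_smul_tmul, hF, hF, map_smul, of_smul_tmul]
      | h2 x y hx hy => rw [smul_add, map_add, map_add, hx, hy, smul_add])

@[simp] lemma map_tmul (f : A →ₗ[MonoidAlgebra k G] A') (a : A) (v : V) :
    map ρ f (tmul ρ a v) = tmul ρ (f a) v := rfl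

lemma map_surjective {f : A →ₗ[MonoidAlgebra k G] A'} (hf : Function.Surjective f) :
    Function.Surjective (map ρ f) :=
  LinearMap.rTensor_surjective (g := scalarMap f) V hf

lemma map_injective [Module.Flat k V] {f : A →ₗ[MonoidAlgebra k G] A'}
    (hf : Function.Injective f) : Function.Injective (map ρ f) :=
  Module.Flat.rTensor_preserves_injective_linearMap (M := V) (scalarMap f) hf

lemma map_exact {f : A →ₗ[MonoidAlgebra k G] A'} {f' : A' →ₗ[MonoidAlgebra k G] A''}
    (h : Function.Exact f f') (hs : Function.Surjective f') :
    Function.Exact (map ρ f) (map ρ f') := by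
  have := @rTensor_exact k (RestrictScalars k (MonoidAlgebra k G) A)
    (RestrictScalars k (MonoidAlgebra k G) A') (RestrictScalars k (MonoidAlgebra k G) A'') _
    ‹AddCommGroup A› ‹AddCommGroup A'› ‹AddCommGroup A''› (RestrictScalars.module k _ A)
    (RestrictScalars.module k _ A') (RestrictScalars.module k _ A'') (scalarMap f) (scalarMap f')
    V _ _ h hs
  exact fun x => this x

end Tens

lemma IsSES.tens [Module.Flat k V] {f : A →ₗ[MonoidAlgebra k G] A'}
    {f' : A' →ₗ[MonoidAlgebra k G] A''} (h : IsSES f f') :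
    IsSES (Tens.map ρ f) (Tens.map ρ f') :=
  ⟨Tens.map_injective h.inj, Tens.map_exact h.exact h.surj, Tens.map_surjective h.surj⟩

/-- A left adjoint preserves projectives when its right adjoint preserves surjections; Hom_k(V, -)
does so because V is k-projective. -/
lemma projective_tens [Module.Projective k V] [Module.Projective (MonoidAlgebra k G) A] :
    Module.Projective (MonoidAlgebra k G) (Tens ρ A) := by
  refine Module.Projective.of_lifting_property'' fun p hp => ?_
  obtain ⟨h, hh⟩ := Module.projective_lifting_property (LinHom.map ρ p)
    (Tens.curry (LinearMap.id : Tens ρ A →ₗ[MonoidAlgebra k G] Tens ρ A))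
    (LinHom.map_surjective hp)
  refine ⟨Tens.uncurry h, LinearMap.ext (Tens.hom_ext fun a v => ?_)⟩
  exact congrArg (fun φ => LinHom.app φ v) (LinearMap.congr_fun hh a)

lemma LinHom.nonempty_ker_equiv (p : Y →ₗ[MonoidAlgebra k G] Y') :
    Nonempty (LinHom ρ (LinearMap.ker p) ≃ₗ[MonoidAlgebra k G]
      LinearMap.ker (LinHom.map ρ p)) := by
  refine ⟨LinearEquiv.ofBijective ((LinHom.map ρ (LinearMap.ker p).subtype).codRestrict _
    fun φ => LinHom.ext (φ := LinHom.map ρ p (LinHom.map ρ (LinearMap.ker p).subtype φ))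
      (ψ := 0) fun v => (φ.app v).2) ⟨fun φ ψ h => LinHom.ext fun v => ?_, fun φ => ?_⟩⟩
  · exact Subtype.ext (congrArg (fun χ : LinearMap.ker (LinHom.map ρ p) => χ.1.app v) h)
  · have hφ : ∀ v, p (φ.1.app v) = 0 := fun v =>
      congrArg (fun χ : LinHom ρ Y' => χ.app v) φ.2
    exact ⟨LinHom.mk ρ
      { toFun := fun v => ⟨φ.1.app v, hφ v⟩
        map_zero' := Subtype.ext (LinHom.toLin φ.1).map_zero
        map_add' := fun v w => Subtype.ext (φ.1.app_add v w) }
      (fun c v => Subtype.ext (φ.1.app_smul c v)), rfl⟩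

/-- By adjunction, splitting the free cover of A ⊗ V means lifting a map out of A along Hom_k(V,
cover); the kernel of that surjection is again of the form Hom_k(V, Z). -/
lemma projective_tens_of_extVanish {V : Type (max u v)} {A : Type (max u v w)} {k : Type u}
    {G : Type v} [CommRing k] [Group G] [AddCommGroup V] [Module k V] (ρ : Representation k G V)
    [AddCommGroup A] [Module (MonoidAlgebra k G) A] [Module.Projective k V]
    (h : ∀ (Z : Type (max u v w)) [AddCommGroup Z] [Module (MonoidAlgebra k G) Z],
      ExtVanish (MonoidAlgebra k G) A (LinHom ρ Z)) :
    Module.Projective (MonoidAlgebra k G) (Tens ρ A) := by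
  let T := Tens ρ A
  let p : FreeCover (MonoidAlgebra k G) T →ₗ[MonoidAlgebra k G] T :=
    FreeCover.proj (MonoidAlgebra k G) T
  obtain ⟨e⟩ := LinHom.nonempty_ker_equiv ρ p
  obtain ⟨t, ht⟩ := ((h (LinearMap.ker p)).congr_right e).lift
    (LinHom.map_surjective (ρ := ρ) FreeCover.proj_surjective) (Tens.curry LinearMap.id)
  refine projective_of_retract (Tens.uncurry t) p (Tens.hom_ext (f := p.comp (Tens.uncurry t))
    (f' := LinearMap.id) fun a v => ?_)
  exact congrArg (fun φ => LinHom.app φ v) (ht a)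

/-- After tensoring with V the free presentation of A splits, so the adjoint of any map from the
relations extends. -/
lemma extVanish_linHom [Module.Flat k V] [Module.Projective (MonoidAlgebra k G) (Tens ρ A)] :
    ExtVanish (MonoidAlgebra k G) A (LinHom ρ Y) := by
  refine extVanish_of_presentation (isSES_ker FreeCover.proj_surjective) fun f => ?_
  obtain ⟨r, hr⟩ := ((isSES_ker (FreeCover.proj_surjective (R := MonoidAlgebra k G)
    (M := A))).tens ρ).exists_retraction ExtVanish.of_projective
  refine ⟨Tens.curry ((Tens.uncurry f).comp r), fun a => LinHom.ext fun v => ?_⟩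
  have := hr (Tens.tmul ρ a v)
  rw [Tens.map_tmul] at this
  rw [Tens.curry_app, LinearMap.comp_apply, this]
  rfl

end DiagonalTensor

/-! ### Freeness of the module of bounded functions -/

section BoundedFunctions

variable (k : Type u) (G : Type v)

/-- Restriction identifies locally constant functions on the Stone-Čech compactification with
bounded functions. -/
noncomputable def ultrafilterRestrict :
    LocallyConstant (Ultrafilter G) ℤ →ₗ[ℤ] boundedFun G where
  toFun f := ⟨fun x => f (pure x), by
    obtain ⟨C, hC⟩ := (f.range_finite.image (fun n : ℤ => |n|)).bddAbove
    exact ⟨C, fun x => hC ⟨_, ⟨_, rfl⟩, rfl⟩⟩⟩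
  map_add' _ _ := rfl
  map_smul' _ _ := rfl

lemma ultrafilterRestrict_bijective : Function.Bijective (ultrafilterRestrict G) := by
  constructor
  · intro f f' h
    have : (f : Ultrafilter G → ℤ) = f' :=
      denseRange_pure.equalizer f.continuous f'.continuous
        (funext fun x => congrFun (congrArg Subtype.val h) x)
    exact DFunLike.coe_injective this
  · rintro ⟨f, C, hC⟩
    -- The finite interval is a compact Hausdorff target, as extension to ultrafilters requires; it
    -- is discrete, so the extension is locally constant.
    let f' : G → Set.Icc (-C) C := fun x => ⟨f x, abs_le.1 (hC x)⟩
    have : IsLocallyConstant (fun u => ((Ultrafilter.extend f' u : Set.Icc (-C) C) : ℤ)) :=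
      (IsLocallyConstant.iff_continuous _).2
        (continuous_subtype_val.comp (continuous_ultrafilter_extend f'))
    refine ⟨⟨_, this⟩, Subtype.ext (funext fun x => ?_)⟩
    exact congrArg Subtype.val (congrFun (ultrafilter_extend_extends f') x)

/-- Nöbeling: the group of bounded functions is free. -/
lemma free_boundedFun : Module.Free ℤ (boundedFun G) := by
  have : Module.Free ℤ (LocallyConstant (Ultrafilter G) ℤ) :=
    LocallyConstant.freeOfProfinite (Profinite.of (Ultrafilter G))
  exact Module.Free.of_equiv (LinearEquiv.ofBijective _ (ultrafilterRestrict_bijective G))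

/-- The `k`-module of bounded functions is free. -/
instance free_tensor_boundedFun [CommRing k] : Module.Free k (k ⊗[ℤ] boundedFun G) :=
  have := free_boundedFun G
  inferInstance

variable [CommRing k] [Group G]

/-- The constant function one. -/
def boundedOne : boundedFun G := ⟨fun _ => 1, 1, fun _ => by simp⟩

lemma boundedRep_one (g : G) :
    boundedRep k G g (1 ⊗ₜ boundedOne G) = 1 ⊗ₜ boundedOne G := rfl

/-- Evaluation at the neutral element. -/
noncomputable def boundedEval : k ⊗[ℤ] boundedFun G →ₗ[k] k :=
  TensorProduct.AlgebraTensorModule.lift (LinearMap.toSpanSingleton k (boundedFun G →ₗ[ℤ] k)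
    (((Int.castAddHom k).toIntLinearMap).comp
      ((LinearMap.proj 1).comp (boundedFun G).subtype)))

lemma boundedEval_one : boundedEval k G (1 ⊗ₜ boundedOne G) = 1 := by
  simp [boundedEval, boundedOne]

end BoundedFunctions

/-! ### Embedding A in A ⊗ V by an invariant vector -/

section Cosyzygy

variable {k G : Type*} [CommRing k] [Group G]
  {V : Type*} [AddCommGroup V] [Module k V] (ρ : Representation k G V)

/-- The quotient of a representation by the line spanned by an invariant vector. -/
def quotientRep {e : V} (he : ∀ g, ρ g e = e) : Representation k G (V ⧸ k ∙ e) where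
  toFun g := (k ∙ e).mapQ (k ∙ e) (ρ g)
    ((Submodule.span_singleton_le_iff_mem _ _).2 (by
      rw [Submodule.mem_comap, he]; exact Submodule.mem_span_singleton_self e))
  map_one' := by
    ext x
    simp
  map_mul' g h := by
    ext x
    simp

variable {ρ} {e : V} (he : ∀ g, ρ g e = e) (ε : V →ₗ[k] k) (hε : ε e = 1)

include ε hε in
lemma exists_section_quotient_span :
    ∃ s : (V ⧸ k ∙ e) →ₗ[k] V, ∀ v, s ((k ∙ e).mkQ v) = v - ε v • e := by
  obtain ⟨s, hs⟩ := exists_comp_eq_of_ker_le (k ∙ e).mkQ (Submodule.mkQ_surjective _)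
    (LinearMap.id - (LinearMap.toSpanSingleton k V e).comp ε) (fun x hx => by
      obtain ⟨c, rfl⟩ := Submodule.mem_span_singleton.1 ((Submodule.Quotient.mk_eq_zero _).1 hx)
      simp [hε])
  exact ⟨s, fun v => by rw [hs]; simp⟩

include ε hε in
lemma projective_quotient_span [Module.Projective k V] : Module.Projective k (V ⧸ k ∙ e) := by
  obtain ⟨s, hs⟩ := exists_section_quotient_span ε hε
  refine projective_of_retract s (k ∙ e).mkQ fun x => ?_
  obtain ⟨v, rfl⟩ := Submodule.mkQ_surjective _ x
  rw [hs, map_sub, map_smul, show (k ∙ e).mkQ e = 0 from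
    (Submodule.Quotient.mk_eq_zero _).2 (Submodule.mem_span_singleton_self e), smul_zero, sub_zero]

variable {A : Type*} [AddCommGroup A] [Module (MonoidAlgebra k G) A]

namespace Tens

/-- The embedding given by an invariant vector. -/
noncomputable def inl : A →ₗ[MonoidAlgebra k G] Tens ρ A :=
  groupAlgebraLinearMap
    { toFun := fun a => tmul ρ a e
      map_zero' := zero_tmul e
      map_add' := fun a b => add_tmul a b e }
    (fun c a => (algebraMap_smul_tmul c a e).symm)
    (fun g a => ((of_smul_tmul g a e).trans (by rw [he]; rfl)).symm)

/-- The projection to the quotient by an invariant vector. -/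
noncomputable def mkQ : Tens ρ A →ₗ[MonoidAlgebra k G] Tens (quotientRep ρ he) A :=
  let F : Tens ρ A →+ Tens (quotientRep ρ he) A :=
    (LinearMap.lTensor (RestrictScalars k (MonoidAlgebra k G) A) (k ∙ e).mkQ).toAddMonoidHom
  have hF : ∀ a v, F (tmul ρ a v) = tmul (quotientRep ρ he) a ((k ∙ e).mkQ v) := fun a v => rfl
  groupAlgebraLinearMap F
    (fun c x => by
      induction x using induction_on with
      | h0 => simp
      | h1 a v => rw [algebraMap_smul_tmul, hF, hF, algebraMap_smul_tmul]
      | h2 x y hx hy => rw [smul_add, map_add, map_add, hx, hy, smul_add])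
    (fun g x => by
      induction x using induction_on with
      | h0 => simp
      | h1 a v => rw [of_smul_tmul, hF, hF, of_smul_tmul]; rfl
      | h2 x y hx hy => rw [smul_add, map_add, map_add, hx, hy, smul_add])

-- The sequence splits additively by means of `ε`, which need not be equivariant: `key` is the
-- contracting homotopy, and exactness needs no more.
include ε hε in
lemma isSES_inl_mkQ : IsSES (inl he : A →ₗ[MonoidAlgebra k G] Tens ρ A) (mkQ he) := by
  let A' := RestrictScalars k (MonoidAlgebra k G) A
  let r : Tens ρ A →+ A := ((TensorProduct.rid k A').toLinearMap.comp
    (LinearMap.lTensor A' ε)).toAddMonoidHom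
  have hr : ∀ a v, r (tmul ρ a v) = algebraMap k (MonoidAlgebra k G) (ε v) • a := fun a v => rfl
  obtain ⟨s, hs⟩ := exists_section_quotient_span ε hε
  let θ : Tens (quotientRep ρ he) A →+ Tens ρ A := (LinearMap.lTensor A' s).toAddMonoidHom
  have hθ : ∀ a v, θ (mkQ he (tmul ρ a v)) = tmul ρ a (s ((k ∙ e).mkQ v)) := fun a v => rfl
  have key : ∀ x : Tens ρ A, θ (mkQ he x) + inl he (r x) = x := fun x => by
    induction x using induction_on with
    | h0 => simp
    | h1 a v =>
      rw [hθ, hs, hr]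
      change _ + tmul ρ _ e = _
      rw [← algebraMap_smul_tmul, ← tmul_smul, ← tmul_add, sub_add_cancel]
    | h2 x y hx hy =>
      rw [map_add, map_add, map_add, map_add, ← add_add_add_comm, hx, hy]
  refine ⟨fun a b h => ?_, fun x => ⟨fun hx => ⟨r x, ?_⟩, ?_⟩, ?_⟩
  · have := congrArg r h
    change r (tmul ρ a e) = r (tmul ρ b e) at this
    rwa [hr, hr, hε, map_one, one_smul, one_smul] at this
  · have := key x
    rwa [hx, map_zero, zero_add] at this
  · rintro ⟨a, rfl⟩
    change tmul (quotientRep ρ he) a ((k ∙ e).mkQ e) = 0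
    rw [show (k ∙ e).mkQ e = 0 from
      (Submodule.Quotient.mk_eq_zero _).2 (Submodule.mem_span_singleton_self e), tmul_zero]
  · exact LinearMap.lTensor_surjective (g := (k ∙ e).mkQ) A' (Submodule.mkQ_surjective _)

end Tens

namespace LinHom

variable {W : Type*} [AddCommGroup W] [Module k W] {σ : Representation k G W}
  {Y : Type*} [AddCommGroup Y] [Module (MonoidAlgebra k G) Y]

/-- Exchanging the two variables, with the second one fixed. -/
noncomputable def flipApp (φ : LinHom ρ (LinHom σ Y)) (w : W) : LinHom ρ Y :=
  LinHom.mk ρ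
    { toFun := fun v => (φ.app v).app w
      map_zero' := by rw [show φ.app 0 = 0 from (toLin φ).map_zero, zero_app]
      map_add' := fun v v' => by rw [app_add, add_app] }
    (fun c v => by
      change (φ.app (c • v)).app w = _ • (φ.app v).app w
      rw [app_smul, algebraMap_smul_app])

lemma flipApp_app (φ : LinHom ρ (LinHom σ Y)) (w : W) (v : V) :
    (flipApp φ w).app v = (φ.app v).app w := rfl

/-- Exchanging the two variables. -/
noncomputable def flipFun (φ : LinHom ρ (LinHom σ Y)) : LinHom σ (LinHom ρ Y) :=
  LinHom.mk σ
    { toFun := flipApp φ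
      map_zero' := LinHom.ext fun v => (toLin (φ.app v)).map_zero
      map_add' := fun w w' => LinHom.ext fun v => by
        rw [add_app, flipApp_app, flipApp_app, flipApp_app, app_add] }
    (fun c w => LinHom.ext fun v => by
      rw [algebraMap_smul_app]
      exact app_smul _ c w)

lemma flipFun_app (φ : LinHom ρ (LinHom σ Y)) (w : W) (v : V) :
    ((flipFun φ).app w).app v = (φ.app v).app w := rfl

lemma ext₂ {φ ψ : LinHom ρ (LinHom σ Y)} (h : ∀ v w, (φ.app v).app w = (ψ.app v).app w) :
    φ = ψ :=
  LinHom.ext fun v => LinHom.ext fun w => h v w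

/-- Exchanging the two variables, as a linear map. -/
noncomputable def flip : LinHom ρ (LinHom σ Y) →ₗ[MonoidAlgebra k G] LinHom σ (LinHom ρ Y) :=
  groupAlgebraLinearMap
    { toFun := flipFun
      map_zero' := rfl
      map_add' := fun φ ψ => ext₂ fun w v => by
        rw [add_app, add_app, flipFun_app, flipFun_app, flipFun_app, add_app, add_app] }
    (fun c φ => ext₂ fun w v => by
      change ((flipFun _).app w).app v = ((_ • flipFun φ : LinHom σ (LinHom ρ Y)).app w).app v
      rw [flipFun_app, algebraMap_smul_app, algebraMap_smul_app, algebraMap_smul_app,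
        algebraMap_smul_app, flipFun_app])
    (fun g φ => ext₂ fun w v => by
      change ((flipFun _).app w).app v = ((_ • flipFun φ : LinHom σ (LinHom ρ Y)).app w).app v
      rw [flipFun_app, of_smul_app, of_smul_app, of_smul_app, of_smul_app, flipFun_app])

end LinHom

namespace Tens

/-- Exchanging two factors of an iterated tensor product. -/
noncomputable def swap {W : Type*} [AddCommGroup W] [Module k W] (ρ : Representation k G V)
    (σ : Representation k G W) : Tens ρ (Tens σ A) →ₗ[MonoidAlgebra k G] Tens σ (Tens ρ A) :=
  uncurry (uncurry (LinHom.flip.comp (curry (curry LinearMap.id))))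

lemma swap_swap {W : Type*} [AddCommGroup W] [Module k W] (ρ : Representation k G V)
    (σ : Representation k G W) (x : Tens ρ (Tens σ A)) : swap σ ρ (swap ρ σ x) = x := by
  refine hom_ext (f := (swap σ ρ).comp (swap ρ σ)) (f' := LinearMap.id) (fun x v => ?_) x
  induction x using induction_on with
  | h0 => rw [zero_tmul, map_zero, map_zero]
  | h1 a w => rfl
  | h2 x y hx hy => rw [add_tmul, map_add, map_add, hx, hy]

end Tens

end Cosyzygy

/-! ### Extensions of projectives and pushouts -/

section Extensions

variable {R : Type*} [Ring R] {A E M N P F : Type*} [AddCommGroup A] [AddCommGroup E]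
  [AddCommGroup M] [AddCommGroup N] [AddCommGroup P] [AddCommGroup F]
  [Module R A] [Module R E] [Module R M] [Module R N] [Module R P] [Module R F]

lemma projective_of_isSES [Module.Projective R A] [Module.Projective R M] {i : A →ₗ[R] E}
    {p : E →ₗ[R] M} (hip : IsSES i p) : Module.Projective R E := by
  obtain ⟨s, hs⟩ := hip.exists_section ExtVanish.of_projective
  obtain ⟨r, hr⟩ := hip.exists_lift (LinearMap.id - s.comp p) (fun x => by simp [hs])
  exact projective_of_retract (M := A × M) (r.prod p) (i.coprod s) fun x => by simp [hr]

/-- The pushout of two short exact sequences with the same sub. -/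
lemma IsSES.exists_pushout {i : N →ₗ[R] P} {p : P →ₗ[R] M} (hip : IsSES i p) {j : N →ₗ[R] E}
    {q : E →ₗ[R] F} (hjq : IsSES j q) :
    ∃ (a : E →ₗ[R] (E × P) ⧸ LinearMap.range (j.prod (-i)))
      (b : ((E × P) ⧸ LinearMap.range (j.prod (-i))) →ₗ[R] M)
      (c : P →ₗ[R] (E × P) ⧸ LinearMap.range (j.prod (-i)))
      (d : ((E × P) ⧸ LinearMap.range (j.prod (-i))) →ₗ[R] F), IsSES a b ∧ IsSES c d := by
  let α := (LinearMap.range (j.prod (-i))).mkQ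
  have hα : ∀ y x, α (y, x) = 0 ↔ ∃ n, j n = y ∧ -i n = x := fun y x =>
    (Submodule.Quotient.mk_eq_zero _).trans (exists_congr fun k => Prod.ext_iff)
  have hα' : ∀ y x y' x', α (y, x) = α (y', x') ↔ ∃ n, j n = y - y' ∧ -i n = x - x' :=
    fun y x y' x' => by
      rw [← sub_eq_zero, ← map_sub]
      exact hα (y - y') (x - x')
  obtain ⟨b, hb⟩ := exists_comp_eq_of_ker_le α (Submodule.mkQ_surjective _)
    (p.comp (LinearMap.snd R E P)) (by
      rintro ⟨y, x⟩ h
      obtain ⟨n, -, rfl⟩ := (hα y x).1 h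
      change p (-i n) = 0
      rw [map_neg, hip.zero, neg_zero])
  obtain ⟨d, hd⟩ := exists_comp_eq_of_ker_le α (Submodule.mkQ_surjective _)
    (q.comp (LinearMap.fst R E P)) (by
      rintro ⟨y, x⟩ h
      obtain ⟨n, rfl, -⟩ := (hα y x).1 h
      exact hjq.zero n)
  replace hb : ∀ y x, b (α (y, x)) = p x := fun y x => hb _
  replace hd : ∀ y x, d (α (y, x)) = q y := fun y x => hd _
  refine ⟨α.comp (LinearMap.inl R E P), b, α.comp (LinearMap.inr R E P), d,
    ⟨?_, ?_, ?_⟩, ?_, ?_, ?_⟩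
  · rw [injective_iff_map_eq_zero]
    intro y hy
    obtain ⟨n, rfl, hn⟩ := (hα y 0).1 hy
    rw [hip.inj ((neg_eq_zero.1 hn).trans (map_zero i).symm), map_zero]
  · intro z
    obtain ⟨⟨y, x⟩, rfl⟩ := Submodule.mkQ_surjective _ z
    rw [hb]
    constructor
    · intro hx
      obtain ⟨n, rfl⟩ := (hip.exact x).1 hx
      exact ⟨y + j n, (hα' (y + j n) 0 y (i n)).2 ⟨n, by simp, by simp⟩⟩
    · rintro ⟨y', hy'⟩
      obtain ⟨n, -, hn⟩ := (hα' y' 0 y x).1 hy'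
      rw [zero_sub, neg_inj] at hn
      rw [← hn, hip.zero]
  · intro m
    obtain ⟨x, rfl⟩ := hip.surj m
    exact ⟨α (0, x), hb _ _⟩
  · rw [injective_iff_map_eq_zero]
    intro x hx
    obtain ⟨n, hn, rfl⟩ := (hα 0 x).1 hx
    rw [hjq.inj (hn.trans (map_zero j).symm), map_zero, neg_zero]
  · intro z
    obtain ⟨⟨y, x⟩, rfl⟩ := Submodule.mkQ_surjective _ z
    rw [hd]
    constructor
    · intro hy
      obtain ⟨n, rfl⟩ := (hjq.exact y).1 hy
      exact ⟨x + i n, (hα' 0 (x + i n) (j n) x).2 ⟨-n, by simp, by simp⟩⟩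
    · rintro ⟨x', hx'⟩
      obtain ⟨n, hn, -⟩ := (hα' 0 x' y x).1 hx'
      rw [← neg_eq_zero, ← map_neg, ← zero_sub, ← hn, hjq.zero]
  · intro m
    obtain ⟨y, rfl⟩ := hjq.surj m
    exact ⟨α (y, 0), hd _ _⟩

end Extensions

/-! ### Subquotients compatible with a section of the free cover -/

section Supported

variable {R : Type*} [Ring R] {T : Type*} [AddCommGroup T] [Module R T]

/-- Subquotients of a projective module which are compatible with a section of its free cover
are projective. -/
lemma projective_map_mkQ {s : T →ₗ[R] (T →₀ R)}
    (hs : ∀ t, Finsupp.linearCombination R (id : T → T) (s t) = t) {T' T'' : Submodule R T}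
    (h' : T' ≤ (Finsupp.supported R R (T' : Set T)).comap s)
    (h'' : T'' ≤ (Finsupp.supported R R (T'' : Set T)).comap s) :
    Module.Projective R (T''.map T'.mkQ) := by
  classical
  let Q := T''.map T'.mkQ
  let q : T'' →ₗ[R] Q := T'.mkQ.submoduleMap T''
  have hq : Function.Surjective q := T'.mkQ.submoduleMap_surjective T''
  let q' : T → Q := fun t => if h : t ∈ T'' then q ⟨t, h⟩ else 0
  have hq' : ∀ t ∈ T'', (q' t : T ⧸ T') = T'.mkQ t := fun t ht => by
    simp only [q', dif_pos ht]; rfl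
  -- Elements of class zero go to 0 and not to the basis vector indexed by 0: this makes `θ` vanish
  -- on everything supported on T', so that `θ ∘ s` descends to the quotient.
  let θ : (T →₀ R) →ₗ[R] (Q →₀ R) := Finsupp.linearCombination R
    (fun t => if q' t = 0 then 0 else Finsupp.single (q' t) 1)
  have hθ : ∀ x, Finsupp.linearCombination R (id : Q → Q) (θ x) =
      Finsupp.linearCombination R q' x := fun x => by
    change ((Finsupp.linearCombination R (id : Q → Q)).comp θ) x = _
    congr 1
    ext t : 1
    ext
    by_cases h : q' t = 0 <;> simp [θ, h]
  have hmk : ∀ x ∈ Finsupp.supported R R (T'' : Set T),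
      ((Finsupp.linearCombination R q' x : Q) : T ⧸ T') =
        T'.mkQ (Finsupp.linearCombination R (id : T → T) x) := fun x hx => by
    rw [Finsupp.supported_eq_span_single] at hx
    refine LinearMap.eqOn_span (f := Q.subtype.comp (Finsupp.linearCombination R q'))
      (g := T'.mkQ.comp (Finsupp.linearCombination R (id : T → T))) ?_ hx
    rintro _ ⟨t, ht, rfl⟩
    simpa using hq' t ht
  have hzero : ∀ x ∈ Finsupp.supported R R (T' : Set T), θ x = 0 := fun x hx => by
    rw [Finsupp.supported_eq_span_single] at hx
    refine LinearMap.eqOn_span (f := θ) (g := 0) ?_ hx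
    rintro _ ⟨t, ht, rfl⟩
    have : q' t = 0 := by
      by_cases h : t ∈ T''
      · exact Subtype.ext ((hq' t h).trans ((Submodule.Quotient.mk_eq_zero _).2 ht))
      · simp [q', h]
    simp [θ, this]
  obtain ⟨σ, hσ⟩ := exists_comp_eq_of_ker_le q hq ((θ.comp s).comp T''.subtype) (fun x hx =>
    hzero _ (h' ((Submodule.Quotient.mk_eq_zero _).1 (congrArg Subtype.val hx))))
  refine ⟨σ, fun x => ?_⟩
  obtain ⟨y, rfl⟩ := hq x
  rw [hσ]
  refine (hθ _).trans (Subtype.ext ((hmk _ (h'' y.2)).trans ?_))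
  change T'.mkQ (Finsupp.linearCombination R (id : T → T) (s y)) = T'.mkQ y
  rw [hs]

end Supported

/-! ### Section-closed submodules and their generators -/

section TensRange

variable {k G : Type*} [CommRing k] [Group G]
  {V : Type*} [AddCommGroup V] [Module k V] (ρ : Representation k G V)
  {A : Type*} [AddCommGroup A] [Module (MonoidAlgebra k G) A]

/-- The image of `A' ⊗ V` in `A ⊗ V` for a submodule `A'` of `A`. -/
noncomputable def tensRange (A' : Submodule (MonoidAlgebra k G) A) :
    Submodule (MonoidAlgebra k G) (Tens ρ A) := LinearMap.range (Tens.map ρ A'.subtype)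

variable {ρ}

lemma tmul_mem_tensRange {A' : Submodule (MonoidAlgebra k G) A} {a : A} (ha : a ∈ A') (v : V) :
    Tens.tmul ρ a v ∈ tensRange ρ A' := ⟨Tens.tmul ρ ⟨a, ha⟩ v, rfl⟩

lemma mem_ker_curry_mkQ {L : Submodule (MonoidAlgebra k G) (Tens ρ A)} {a : A} :
    a ∈ LinearMap.ker (Tens.curry L.mkQ) ↔ ∀ v, Tens.tmul ρ a v ∈ L := by
  constructor
  · exact fun h v => (Submodule.Quotient.mk_eq_zero L).1 (congrArg (fun φ => LinHom.app φ v) h)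
  · exact fun h => LinearMap.mem_ker.2 (LinHom.ext fun v =>
      (Submodule.Quotient.mk_eq_zero L).2 (h v))

/-- A Galois connection coming from the adjunction: it reduces containments in A ⊗ V to containments
in A, where suprema and spans are checked on generators. -/
lemma tensRange_le_iff {A' : Submodule (MonoidAlgebra k G) A}
    {L : Submodule (MonoidAlgebra k G) (Tens ρ A)} :
    tensRange ρ A' ≤ L ↔ A' ≤ LinearMap.ker (Tens.curry L.mkQ) := by
  constructor
  · exact fun h a ha => mem_ker_curry_mkQ.2 fun v => h (tmul_mem_tensRange ha v)
  · rintro h _ ⟨x, rfl⟩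
    induction x using Tens.induction_on with
    | h0 => rw [map_zero]; exact L.zero_mem
    | h1 a v => exact mem_ker_curry_mkQ.1 (h a.2) v
    | h2 x y hx hy => rw [map_add]; exact L.add_mem hx hy

lemma tensRange_mono {A' A'' : Submodule (MonoidAlgebra k G) A} (h : A' ≤ A'') :
    tensRange ρ A' ≤ tensRange ρ A'' :=
  tensRange_le_iff.2 fun _ ha => mem_ker_curry_mkQ.2 (tmul_mem_tensRange (h ha))

lemma exists_finite_mem_tensRange (t : Tens ρ A) :
    ∃ X : Set A, X.Finite ∧ t ∈ tensRange ρ (Submodule.span (MonoidAlgebra k G) X) := by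
  induction t using Tens.induction_on with
  | h0 => exact ⟨∅, Set.finite_empty, Submodule.zero_mem _⟩
  | h1 a v => exact ⟨{a}, Set.finite_singleton a,
      tmul_mem_tensRange (Submodule.subset_span (Set.mem_singleton a)) v⟩
  | h2 x y hx hy =>
    obtain ⟨S, hS, hx⟩ := hx
    obtain ⟨S', hS', hy⟩ := hy
    exact ⟨S ∪ S', hS.union hS', Submodule.add_mem _
      (tensRange_mono (Submodule.span_mono Set.subset_union_left) hx)
      (tensRange_mono (Submodule.span_mono Set.subset_union_right) hy)⟩

lemma exists_sequence_mem_tensRange (F : Set (Tens ρ A)) (hF : F.Finite) :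
    ∃ x : ℕ → A, F ⊆ tensRange ρ (Submodule.span (MonoidAlgebra k G) (Set.range x)) := by
  choose S hS hmem using fun t : Tens ρ A => exists_finite_mem_tensRange t
  have hfin : (insert 0 (⋃ t ∈ F, S t)).Finite := (hF.biUnion fun t _ => hS t).insert 0
  obtain ⟨x, hx⟩ := hfin.countable.exists_eq_range ⟨0, Set.mem_insert _ _⟩
  refine ⟨x, fun t ht => ?_⟩
  rw [← hx]
  refine tensRange_mono (Submodule.span_mono ?_) (hmem t)
  exact (Set.subset_biUnion_of_mem (u := S) ht).trans (Set.subset_insert _ _)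

lemma Tens.nonempty_equiv_map_mkQ [Module.Flat k V] {A' A'' : Submodule (MonoidAlgebra k G) A}
    (h : A' ≤ A'') : Nonempty (((tensRange ρ A'').map (tensRange ρ A').mkQ) ≃ₗ[MonoidAlgebra k G]
      Tens ρ (A''.map A'.mkQ)) := by
  let ψ : Tens ρ A'' →ₗ[MonoidAlgebra k G] (tensRange ρ A'').map (tensRange ρ A').mkQ :=
    ((tensRange ρ A').mkQ.submoduleMap (tensRange ρ A'')).comp (Tens.map ρ A''.subtype).rangeRestrict
  have hψ : Function.Surjective ψ :=
    ((tensRange ρ A').mkQ.submoduleMap_surjective _).comp (LinearMap.surjective_rangeRestrict _)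
  have hex : IsSES (Submodule.inclusion h) (A'.mkQ.submoduleMap A'') := by
    refine ⟨Submodule.inclusion_injective h, fun x => ?_, A'.mkQ.submoduleMap_surjective A''⟩
    rw [Subtype.ext_iff]
    refine (Submodule.Quotient.mk_eq_zero A').trans ⟨fun hx => ⟨⟨x, hx⟩, rfl⟩, ?_⟩
    rintro ⟨y, rfl⟩
    exact y.2
  refine exists_linearEquiv_of_ker_eq ψ hψ _ (hex.tens ρ).surj fun x => ?_
  rw [(hex.tens ρ).exact x, Subtype.ext_iff]
  have hcomp : ∀ y : Tens ρ A', Tens.map ρ A''.subtype (Tens.map ρ (Submodule.inclusion h) y) =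
      Tens.map ρ A'.subtype y := fun y =>
    Tens.hom_ext (f := (Tens.map ρ A''.subtype).comp (Tens.map ρ (Submodule.inclusion h)))
      (f' := Tens.map ρ A'.subtype) (fun a v => rfl) y
  refine (Submodule.Quotient.mk_eq_zero (tensRange ρ A')).trans ⟨?_, ?_⟩
  · rintro ⟨y, hy⟩
    exact ⟨y, Tens.map_injective Subtype.val_injective ((hcomp y).trans hy)⟩
  · rintro ⟨y, rfl⟩
    exact ⟨y, (hcomp y).symm⟩

/-- Submodules of `A` whose image in `A ⊗ V` is compatible with a section of the free cover. -/
def IsSectionClosed (s : Tens ρ A →ₗ[MonoidAlgebra k G] (Tens ρ A →₀ MonoidAlgebra k G))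
    (A' : Submodule (MonoidAlgebra k G) A) : Prop :=
  tensRange ρ A' ≤ (Finsupp.supported (MonoidAlgebra k G) (MonoidAlgebra k G)
    (tensRange ρ A' : Set (Tens ρ A))).comap s

variable {s : Tens ρ A →ₗ[MonoidAlgebra k G] (Tens ρ A →₀ MonoidAlgebra k G)}

lemma isSectionClosed_sSup {S : Set (Submodule (MonoidAlgebra k G) A)}
    (h : ∀ A' ∈ S, IsSectionClosed s A') : IsSectionClosed s (sSup S) := by
  refine tensRange_le_iff.2 (sSup_le fun A' hA' => tensRange_le_iff.1 ((h A' hA').trans ?_))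
  exact Submodule.comap_mono (Finsupp.supported_mono (tensRange_mono (le_sSup hA')))

lemma projective_tens_map_mkQ [Module.Flat k V]
    (hs : ∀ t, Finsupp.linearCombination (MonoidAlgebra k G) (id : Tens ρ A → Tens ρ A) (s t) = t)
    {A' A'' : Submodule (MonoidAlgebra k G) A} (h : A' ≤ A'') (h' : IsSectionClosed s A')
    (h'' : IsSectionClosed s A'') :
    Module.Projective (MonoidAlgebra k G) (Tens ρ (A''.map A'.mkQ)) := by
  obtain ⟨e⟩ := Tens.nonempty_equiv_map_mkQ (ρ := ρ) h
  have := projective_map_mkQ hs h' h''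
  exact Module.Projective.of_equiv e

/-- Closing off: `s (b ⊗ v)` has finite support, so countably many elements `τ b v n` account for
it. Iterating from `a` along lists of pairs (v, n) gives generators indexed by a type that does not
depend on A. -/
lemma exists_isSectionClosed_sup {A' : Submodule (MonoidAlgebra k G) A}
    (h' : IsSectionClosed s A') (a : A) :
    ∃ x : List (V × ℕ) → A, a ∈ Set.range x ∧
      IsSectionClosed s (A' ⊔ Submodule.span (MonoidAlgebra k G) (Set.range x)) := by
  choose τ hτ using fun (b : A) (v : V) => exists_sequence_mem_tensRange
    ((s (Tens.tmul ρ b v)).support : Set (Tens ρ A)) (Finset.finite_toSet _)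
  let x : List (V × ℕ) → A := fun l => l.foldr (fun p b => τ b p.1 p.2) a
  have hx : ∀ l v n, x ((v, n) :: l) = τ (x l) v n := fun l v n => rfl
  refine ⟨x, ⟨[], rfl⟩, tensRange_le_iff.2 (sup_le ?_ (Submodule.span_le.2 ?_))⟩
  · exact tensRange_le_iff.1 (h'.trans (Submodule.comap_mono
      (Finsupp.supported_mono (tensRange_mono le_sup_left))))
  · rintro _ ⟨l, rfl⟩
    refine mem_ker_curry_mkQ.2 fun v => ?_
    refine (Finsupp.mem_supported (MonoidAlgebra k G) _).2 ((hτ (x l) v).trans (tensRange_mono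
      (le_sup_of_le_right (Submodule.span_mono ?_))))
    rintro _ ⟨n, rfl⟩
    exact ⟨(v, n) :: l, hx l v n⟩

end TensRange

/-! ### Cofibrant modules: syzygies, orthogonality and precovers -/

section Cofibrant

lemma isSES_subtype_mkQ {R M : Type*} [Ring R] [AddCommGroup M] [Module R M]
    (L : Submodule R M) : IsSES L.subtype L.mkQ :=
  ⟨Subtype.val_injective, fun x => (Submodule.Quotient.mk_eq_zero L).trans (by simp),
    L.mkQ_surjective⟩

lemma top_le_span_map_mkQ {R M ι κ : Type*} [Ring R] [AddCommGroup M] [Module R M]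
    (D : Submodule R M) (a : ι → M) {j : κ → ι} (hj : Function.Surjective j)
    (h : ∀ l, D.mkQ (a (j l)) ∈ (D ⊔ Submodule.span R (Set.range a)).map D.mkQ) :
    ⊤ ≤ Submodule.span R (Set.range fun l =>
      (⟨D.mkQ (a (j l)), h l⟩ : (D ⊔ Submodule.span R (Set.range a)).map D.mkQ)) := by
  rintro ⟨q, hq⟩ -
  suffices H : q ∈ (Submodule.span R (Set.range fun l =>
      (⟨D.mkQ (a (j l)), h l⟩ : (D ⊔ Submodule.span R (Set.range a)).map D.mkQ))).map
        (Submodule.subtype _) by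
    obtain ⟨x, hx, rfl⟩ := H
    exact hx
  rw [Submodule.map_span, ← Set.range_comp]
  rw [Submodule.map_sup, Submodule.map_span, ← Set.range_comp] at hq
  refine (sup_le ?_ ?_ : _ ≤ Submodule.span R _) hq
  · rintro _ ⟨d, hd, rfl⟩
    rw [show D.mkQ d = 0 from (Submodule.Quotient.mk_eq_zero D).2 hd]
    exact Submodule.zero_mem _
  · refine Submodule.span_mono ?_
    rintro _ ⟨i, rfl⟩
    obtain ⟨l, rfl⟩ := hj i
    exact ⟨l, rfl⟩

variable {k : Type u} {G : Type v} [CommRing k] [Group G]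

lemma cof_iff {M : ModuleCat.{max u v w} (MonoidAlgebra k G)} :
    Cof.{u, v, w} k G M ↔ Module.Projective (MonoidAlgebra k G) (Tens (boundedRep k G) M) :=
  Iff.rfl

lemma projective_tens_of_retract {V : Type*} [AddCommGroup V] [Module k V]
    (ρ : Representation k G V) {A A' : Type*} [AddCommGroup A] [AddCommGroup A']
    [Module (MonoidAlgebra k G) A] [Module (MonoidAlgebra k G) A']
    [Module.Projective (MonoidAlgebra k G) (Tens ρ A)] (s : A' →ₗ[MonoidAlgebra k G] A)
    (r : A →ₗ[MonoidAlgebra k G] A') (h : ∀ x, r (s x) = x) :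
    Module.Projective (MonoidAlgebra k G) (Tens ρ A') :=
  projective_of_retract (Tens.map ρ s) (Tens.map ρ r)
    (Tens.hom_ext (f := (Tens.map ρ r).comp (Tens.map ρ s)) (f' := LinearMap.id) fun a v =>
      congrArg (fun a => Tens.tmul ρ a v) (h a))

lemma proj_le_cof : Proj.{max u v, w} (MonoidAlgebra k G) ≤ Cof.{u, v, w} k G := by
  intro M hM
  have : Module.Projective (MonoidAlgebra k G) M := hM
  exact cof_iff.2 (projective_tens _)

lemma Cof.extVanish_linHom {M : ModuleCat.{max u v w} (MonoidAlgebra k G)}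
    (hM : Cof.{u, v, w} k G M) (Y : Type*) [AddCommGroup Y] [Module (MonoidAlgebra k G) Y] :
    ExtVanish (MonoidAlgebra k G) M (LinHom (boundedRep k G) Y) :=
  have : Module.Projective (MonoidAlgebra k G) (Tens (boundedRep k G) M) := hM
  GorensteinCofibrant.extVanish_linHom _

/-- Evaluation at the invariant vector 1 maps Hom_k(B, P) equivariantly onto P, so P is a summand of
a module already known to be right orthogonal to M. -/
lemma Cof.extVanish_of_projective {M : ModuleCat.{max u v w} (MonoidAlgebra k G)}
    (hM : Cof.{u, v, w} k G M) (P : Type*) [AddCommGroup P] [Module (MonoidAlgebra k G) P]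
    [Module.Projective (MonoidAlgebra k G) P] : ExtVanish (MonoidAlgebra k G) M P := by
  let r : LinHom (boundedRep k G) P →ₗ[MonoidAlgebra k G] P :=
    LinHom.evalInvariant (boundedRep_one k G)
  have hr : Function.Surjective r := fun y =>
    ⟨LinHom.mk _
      { toFun := fun v => algebraMap k (MonoidAlgebra k G) (boundedEval k G v) • y
        map_zero' := by rw [map_zero, map_zero, zero_smul]
        map_add' := fun v v' => by rw [map_add, map_add, add_smul] }
      (fun c v => by
        change algebraMap k (MonoidAlgebra k G) (boundedEval k G (c • v)) • y = algebraMap k (MonoidAlgebra k G) c •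
          algebraMap k (MonoidAlgebra k G) (boundedEval k G v) • y
        rw [map_smul, smul_eq_mul, map_mul, mul_smul]), by
      change algebraMap k (MonoidAlgebra k G) (boundedEval k G (1 ⊗ₜ boundedOne G)) • y = y
      rw [boundedEval_one, map_one, one_smul]⟩
  obtain ⟨s, hs⟩ := Module.projective_lifting_property r LinearMap.id hr
  exact (hM.extVanish_linHom P).retract_right s r fun x => LinearMap.congr_fun hs x

lemma Cof.exists_next {M : ModuleCat.{max u v w} (MonoidAlgebra k G)} (hM : Cof.{u, v, w} k G M) :
    ∃ M', Cof.{u, v, w} k G M' ∧ ProjLink.{max u v, w} M M' := by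
  have : Module.Projective (MonoidAlgebra k G) (Tens (boundedRep k G) M) := hM
  have := projective_quotient_span (boundedEval k G) (boundedEval_one k G)
  refine ⟨ModuleCat.of _ (Tens (quotientRep (boundedRep k G) (boundedRep_one k G)) M), ?_,
    ModuleCat.of _ (Tens (boundedRep k G) M), Tens.inl (boundedRep_one k G), Tens.mkQ _, hM,
    Tens.isSES_inl_mkQ (boundedRep_one k G) (boundedEval k G) (boundedEval_one k G)⟩
  -- The two tensor factors commute, and (M ⊗ B) ⊗ (B/k·1) is projective since M ⊗ B is and B/k·1 is
  -- k-projective.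
  have : Module.Projective (MonoidAlgebra k G) (Tens (quotientRep (boundedRep k G)
    (boundedRep_one k G)) (Tens (boundedRep k G) M)) := projective_tens _
  exact cof_iff.2 (projective_of_retract (Tens.swap _ _) (Tens.swap _ _) (Tens.swap_swap _ _))

lemma Cof.exists_prev {M : ModuleCat.{max u v w} (MonoidAlgebra k G)} (hM : Cof.{u, v, w} k G M) :
    ∃ M', Cof.{u, v, w} k G M' ∧ ProjLink.{max u v, w} M' M := by
  have : Module.Projective (MonoidAlgebra k G) (Tens (boundedRep k G) M) := hM
  have hses : IsSES _ (FreeCover.proj (MonoidAlgebra k G) M) := isSES_ker FreeCover.proj_surjective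
  refine ⟨ModuleCat.of _ (LinearMap.ker (FreeCover.proj (MonoidAlgebra k G) M)), ?_,
    ModuleCat.of _ (FreeCover (MonoidAlgebra k G) M), _, _,
    inferInstanceAs (Module.Projective _ (FreeCover (MonoidAlgebra k G) M)), hses⟩
  obtain ⟨r, hr⟩ := (hses.tens (boundedRep k G)).exists_retraction ExtVanish.of_projective
  have : Module.Projective (MonoidAlgebra k G)
    (Tens (boundedRep k G) (FreeCover (MonoidAlgebra k G) M)) := projective_tens _
  exact cof_iff.2 (projective_of_retract _ r hr)

/-- Cofibrant modules are Gorenstein projective. -/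
lemma cof_le_gproj : Cof.{u, v, w} k G ≤ GProj.{max u v, w} (MonoidAlgebra k G) :=
  le_gproj _ (fun _ h => h.exists_next) (fun _ h => h.exists_prev)
    (fun _ h P _ => h.extVanish_of_projective P)

/-- A module that is left orthogonal to the right orthogonal of the cofibrant modules is
cofibrant. -/
lemma cof_of_extVanish {M : ModuleCat.{max u v w} (MonoidAlgebra k G)}
    (h : ∀ Y : ModuleCat.{max u v w} (MonoidAlgebra k G),
      rightPerp.{max u v, w} (Cof.{u, v, w} k G) Y → ExtVanish (MonoidAlgebra k G) M Y) :
    Cof.{u, v, w} k G M :=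
  cof_iff.2 (projective_tens_of_extVanish.{u, v, w} _ fun Z _ _ =>
    h (ModuleCat.of _ (LinHom (boundedRep k G) Z)) fun _ hC =>
      (subsingleton_ext_iff.{max u v, w} _ _).2 (hC.extVanish_linHom Z))

variable (k G) in
/-- A set of generators which suffices to describe all cofibrant modules. -/
abbrev CofGen : Type (max u v w) := ULift.{w} (List ((k ⊗[ℤ] boundedFun G) × ℕ))

variable (k G) in
/-- The relation modules of the cofibrant modules generated by a set of bounded size. -/
def CofRel : Type (max u v w) :=
  { L : Submodule (MonoidAlgebra k G) (FreeCover (MonoidAlgebra k G) (CofGen.{u, v, w} k G)) //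
    Cof.{u, v, w} k G (ModuleCat.of _ (FreeCover (MonoidAlgebra k G) (CofGen.{u, v, w} k G) ⧸ L)) }

/-- Modules which are injective relative to the presentations of small cofibrant modules. -/
def IsCofRelInjective (Y : ModuleCat.{max u v w} (MonoidAlgebra k G)) : Prop :=
  ∀ (L : CofRel.{u, v, w} k G) (f : L.1 →ₗ[MonoidAlgebra k G] Y),
    ∃ g : FreeCover (MonoidAlgebra k G) (CofGen.{u, v, w} k G) →ₗ[MonoidAlgebra k G] Y,
      ∀ x, g (L.1.subtype x) = f x

lemma IsCofRelInjective.extVanish_of_span {Y : ModuleCat.{max u v w} (MonoidAlgebra k G)}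
    (hY : IsCofRelInjective.{u, v, w} Y) {Q : Type (max u v w)} [AddCommGroup Q]
    [Module (MonoidAlgebra k G) Q] [Module.Projective (MonoidAlgebra k G) (Tens (boundedRep k G) Q)]
    (x : CofGen.{u, v, w} k G → Q) (hx : ⊤ ≤ Submodule.span (MonoidAlgebra k G) (Set.range x)) :
    ExtVanish (MonoidAlgebra k G) Q Y := by
  let p : FreeCover (MonoidAlgebra k G) (CofGen.{u, v, w} k G) →ₗ[MonoidAlgebra k G] Q :=
    Finsupp.linearCombination (MonoidAlgebra k G) x
  have hp : Function.Surjective p := by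
    rw [← LinearMap.range_eq_top, eq_top_iff]
    exact hx.trans (Finsupp.range_linearCombination (MonoidAlgebra k G)).ge
  let e := p.quotKerEquivOfSurjective hp
  have hL : Cof.{u, v, w} k G (ModuleCat.of _
      (FreeCover (MonoidAlgebra k G) (CofGen.{u, v, w} k G) ⧸ LinearMap.ker p)) :=
    cof_iff.2 (projective_tens_of_retract _ e.toLinearMap e.symm.toLinearMap
      e.symm_apply_apply)
  exact extVanish_of_presentation (isSES_ker hp) (hY ⟨_, hL⟩)

/-- Zorn's lemma replaces a transfinite filtration of C: the partial extensions considered have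
domains with section-closed image in C, so each enlargement adds a cofibrant quotient with few
generators, whose Ext¹ into Y vanishes. -/
lemma IsCofRelInjective.extVanish {Y : ModuleCat.{max u v w} (MonoidAlgebra k G)}
    (hY : IsCofRelInjective.{u, v, w} Y) {C : ModuleCat.{max u v w} (MonoidAlgebra k G)}
    (hC : Cof.{u, v, w} k G C) : ExtVanish (MonoidAlgebra k G) C Y := by
  intro f
  obtain ⟨s, hs⟩ := cof_iff.1 hC
  let E := FreeCover (MonoidAlgebra k G) C
  let π : E →ₗ[MonoidAlgebra k G] C := FreeCover.proj (MonoidAlgebra k G) C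
  have hπ : Function.Surjective π := FreeCover.proj_surjective
  let f₀ : E →ₗ.[MonoidAlgebra k G] Y := ⟨LinearMap.ker π, f⟩
  let Z : Set (E →ₗ.[MonoidAlgebra k G] Y) :=
    { g | f₀ ≤ g ∧ IsSectionClosed s (g.domain.map π) }
  have h0 : f₀ ∈ Z := by
    refine ⟨le_rfl, ?_⟩
    rw [show f₀.domain.map π = sSup ∅ by
      rw [sSup_empty, eq_bot_iff]; exact Submodule.map_le_iff_le_comap.2 fun x hx => hx]
    exact isSectionClosed_sSup (by simp)
  obtain ⟨g, -, ⟨hfg, hg⟩, hmax⟩ := zorn_le_nonempty₀ Z (fun c hc hchain y hy => by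
    have hdir := hchain.directedOn
    refine ⟨LinearPMap.sSup c hdir, ⟨(hc hy).1.trans (LinearPMap.le_sSup hdir hy), ?_⟩,
      fun z hz => LinearPMap.le_sSup hdir hz⟩
    have : (LinearPMap.sSup c hdir).domain.map π =
        sSup ((fun g : E →ₗ.[MonoidAlgebra k G] Y => g.domain.map π) '' c) := by
      rw [LinearPMap.domain_sSup, sSup_image, sSup_image]
      simp only [Submodule.map_iSup]
    rw [this]
    refine isSectionClosed_sSup ?_
    rintro _ ⟨z, hz, rfl⟩
    exact (hc hz).2) f₀ h0
  have htop : g.domain = ⊤ := by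
    rw [eq_top_iff]
    rintro x -
    let D := g.domain.map π
    have hD : ∀ y, π y ∈ D ↔ y ∈ g.domain := fun y => by
      refine ⟨?_, fun hy => ⟨y, hy, rfl⟩⟩
      rintro ⟨z, hz, hzy⟩
      have : y - z ∈ LinearMap.ker π := by rw [LinearMap.mem_ker, map_sub, hzy, sub_self]
      have := g.domain.add_mem (hfg.1 this) hz
      rwa [sub_add_cancel] at this
    obtain ⟨a, ha, hclosed⟩ := exists_isSectionClosed_sup hg (π x)
    let D' := D ⊔ Submodule.span (MonoidAlgebra k G) (Set.range a)
    have hDD' : D ≤ D' := le_sup_left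
    have := projective_tens_map_mkQ hs hDD' hg hclosed
    have haD : ∀ l, a l ∈ D' := fun l =>
      (le_sup_right : _ ≤ D') (Submodule.subset_span ⟨l, rfl⟩)
    have hext : ExtVanish (MonoidAlgebra k G) (D'.map D.mkQ) Y :=
      hY.extVanish_of_span (fun l => ⟨D.mkQ (a l.down), a l.down, haD _, rfl⟩) (top_le_span_map_mkQ D _ ULift.down_surjective _)
    let X := D'.comap π
    have hgX : g.domain ≤ X := fun y hy => hDD' ((hD y).2 hy)
    have hses : IsSES (Submodule.inclusion hgX)
        ((D.mkQ.submoduleMap D').comp (π.restrict (p := X) (q := D') fun _ h => h)) := by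
      refine ⟨Submodule.inclusion_injective hgX, fun y => ?_,
        (D.mkQ.submoduleMap_surjective D').comp ?_⟩
      · rw [Subtype.ext_iff]
        refine (Submodule.Quotient.mk_eq_zero D).trans ((hD y).trans ⟨fun h => ⟨⟨y, h⟩, rfl⟩, ?_⟩)
        rintro ⟨z, rfl⟩
        exact z.2
      · rintro ⟨d, hd⟩
        obtain ⟨y, rfl⟩ := hπ d
        exact ⟨⟨y, hd⟩, rfl⟩
    obtain ⟨g', hg'⟩ := hext.extend hses g.toFun
    have hle : g ≤ (⟨X, g'⟩ : E →ₗ.[MonoidAlgebra k G] Y) :=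
      ⟨hgX, fun y z hyz => by
        rw [show z = Submodule.inclusion hgX y from Subtype.ext hyz.symm]
        exact (hg' y).symm⟩
    have hmem : (⟨X, g'⟩ : E →ₗ.[MonoidAlgebra k G] Y) ∈ Z := by
      refine ⟨hfg.trans hle, ?_⟩
      change IsSectionClosed s (X.map π)
      rw [Submodule.map_comap_eq_of_surjective hπ]
      exact hclosed
    refine (hmax hmem hle).1 (show π x ∈ D' from ?_)
    obtain ⟨l, hl⟩ := ha
    rw [← hl]
    exact haD l
  refine ⟨g.toFun.comp (LinearMap.codRestrict g.domain LinearMap.id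
    (fun x => by rw [htop]; trivial)), fun x => ?_⟩
  exact (hfg.2 (x := x) rfl).symm

/-- Special precovers by cofibrant modules. -/
lemma exists_cof_precover (M : ModuleCat.{max u v w} (MonoidAlgebra k G)) :
    ∃ (K C : ModuleCat.{max u v w} (MonoidAlgebra k G)) (i : K →ₗ[MonoidAlgebra k G] C)
      (p : C →ₗ[MonoidAlgebra k G] M), IsSES i p ∧ Cof.{u, v, w} k G C ∧
        rightPerp.{max u v, w} (Cof.{u, v, w} k G) K := by
  let P := FreeCover (MonoidAlgebra k G) M
  let N := LinearMap.ker (FreeCover.proj (MonoidAlgebra k G) M)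
  have hN : IsSES N.subtype (FreeCover.proj (MonoidAlgebra k G) M) :=
    isSES_ker FreeCover.proj_surjective
  obtain ⟨E, e, he, hE, hF⟩ := exists_special_preenvelope.{max u v, w}
    (ι := CofRel.{u, v, w} k G) (A := fun L => ModuleCat.of _ L.1)
    (F := fun _ => ModuleCat.of _ (FreeCover (MonoidAlgebra k G) (CofGen.{u, v, w} k G)))
    (fun L => L.1.subtype) (fun L => Subtype.val_injective)
    (fun _ => inferInstanceAs (Module.Projective (MonoidAlgebra k G)
      (FreeCover (MonoidAlgebra k G) (CofGen.{u, v, w} k G)))) (ModuleCat.of _ N)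
  have hcof : Cof.{u, v, w} k G (ModuleCat.of _ (E ⧸ LinearMap.range e)) :=
    cof_of_extVanish fun Y hY => hF Y fun L f =>
      ExtVanish.extend ((subsingleton_ext_iff.{max u v, w} _ _).1 (hY _ L.2)) (isSES_subtype_mkQ L.1) f
  -- Salce's trick: the pushout is an extension of M by E, and also of E/N by P. The second
  -- description shows that it is cofibrant.
  obtain ⟨a, b, c, d, hab, hcd⟩ := hN.exists_pushout (isSES_mkQ he)
  refine ⟨E, ModuleCat.of _ _, a, b, hab, ?_, fun C hC =>
    (subsingleton_ext_iff.{max u v, w} _ _).2 (IsCofRelInjective.extVanish hE hC)⟩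
  have : Module.Projective (MonoidAlgebra k G) (Tens (boundedRep k G) P) := projective_tens _
  have : Module.Projective (MonoidAlgebra k G)
    (Tens (boundedRep k G) (E ⧸ LinearMap.range e)) := hcof
  exact cof_iff.2 (projective_of_isSES (hcd.tens (boundedRep k G)))

end Cofibrant

end GorensteinCofibrant

/-! ### The equivalence of the four conditions -/

open GorensteinCofibrant in
theorem proposition4p3 (k : Type u) (G : Type v) [CommRing k] [Group G] :
    List.TFAE [
      GorensteinCofibrant.GProj.{max u v, w} (MonoidAlgebra k G) =
        GorensteinCofibrant.Cof.{u, v, w} k G,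
      GorensteinCofibrant.GProj.{max u v, w} (MonoidAlgebra k G) ⊓
          GorensteinCofibrant.rightPerp.{max u v, w} (GorensteinCofibrant.Cof.{u, v, w} k G) =
        GorensteinCofibrant.Proj.{max u v, w} (MonoidAlgebra k G),
      GorensteinCofibrant.GProj.{max u v, w} (MonoidAlgebra k G) ⊓
          GorensteinCofibrant.rightPerp.{max u v, w} (GorensteinCofibrant.Cof.{u, v, w} k G) ≤
        GorensteinCofibrant.Cof.{u, v, w} k G,
      GorensteinCofibrant.GProj.{max u v, w} (MonoidAlgebra k G) ⊓
          GorensteinCofibrant.rightPerp.{max u v, w} (GorensteinCofibrant.Cof.{u, v, w} k G) ≤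
        GorensteinCofibrant.rightPerp.{max u v, w}
          (GorensteinCofibrant.GProj.{max u v, w} (MonoidAlgebra k G))] := by
  have hproj : Proj.{max u v, w} (MonoidAlgebra k G) ≤
      rightPerp.{max u v, w} (GProj.{max u v, w} (MonoidAlgebra k G)) := fun P hP M hM =>
    (subsingleton_ext_iff.{max u v, w} _ _).2 (hM.extVanish P hP)
  have hcof : ∀ M, Cof.{u, v, w} k G M → rightPerp.{max u v, w} (Cof.{u, v, w} k G) M →
      Proj.{max u v, w} (MonoidAlgebra k G) M := fun M hM hM' => by
    -- The cokernel M' is cofibrant, so M in Cof^⊥ splits the embedding into P.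
    obtain ⟨M', hM'', P, i, p, hP, hip⟩ := hM.exists_next
    obtain ⟨r, hr⟩ := hip.exists_retraction
      ((subsingleton_ext_iff.{max u v, w} _ _).1 (hM' _ hM''))
    exact projective_of_retract i r hr
  tfae_have 1 → 2 := fun h => by
    rw [h]
    refine le_antisymm (fun M hM => hcof M hM.1 hM.2) fun P hP => ⟨proj_le_cof P hP, ?_⟩
    rw [← h]
    exact hproj P hP
  tfae_have 2 → 3 := fun h => h.trans_le proj_le_cof
  tfae_have 3 → 4 := fun h M hM => hproj M (hcof M (h M hM) hM.2)
  tfae_have 4 → 1 := fun h => by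
    refine le_antisymm (fun M hM => ?_) cof_le_gproj
    obtain ⟨K, C, i, p, hip, hC, hK⟩ := exists_cof_precover M
    -- K is Gorenstein projective and lies in Cof^⊥, so (iv) gives Ext¹(M, K) = 0.
    obtain ⟨s, hs⟩ := hip.exists_section ((subsingleton_ext_iff.{max u v, w} _ _).1
      (h K ⟨gproj_of_ker hip (cof_le_gproj C hC) hM, hK⟩ M hM))
    have : Module.Projective (MonoidAlgebra k G) (Tens (boundedRep k G) C) := hC
    exact cof_iff.2 (projective_tens_of_retract _ s p hs)
  tfae_finish
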